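/- Let $A=(a_{ij})_{0\le i,j\le 9}$ be the Cartan matrix of $E_{10}$: $a_{ii}=2$, $a_{ij}=-1$ if the nodes $i\ne j$ are joined in the Dynkin diagram, and $a_{ij}=0$ otherwise, where the diagram is the chain $0-1-\cdots-8$ together with a node $9$ joined to the node $6$. Let $\mathfrak g=E_{10}$ be the complex Kac--Moody Lie algebra of $A$, with generators $h_i,e_i,f_i$ and relations $[h_i,h_j]=0$, $[e_i,f_j]=\delta_{ij}h_i$, $[h_i,e_j]=a_{ij}e_j$, $[h_i,f_j]=-a_{ij}f_j$, and $\mathrm{ad}(e_i)^{1-a_{ij}}e_j=\mathrm{ad}(f_i)^{1-a_{ij}}f_j=0$ for $i\ne j$. Identify the dual of its real Cartan subalgebra with $\mathbb R^{10}$ so that the simple roots are $$\alpha_0=(1,-1,0,\dots,0),\ \dots,\ \alpha_8=(0,\dots,0,1,-1),\ \alpha_9=(0,0,0,0,0,0,0,1,1,1),$$ and the inner product is $(n,n')=\sum_i n_in_i'-\frac19\left(\sum_i n_i\right)\left(\sum_i n_i'\right)$; then $n(h_i)=(n,\alpha_i)$. A root is a vector $\alpha\ne0$ with $\mathfrak g_\alpha=\{x\in\mathfrak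 g:[h_i,x]=(\alpha,\alpha_i)\,x\text{ for all }i\}\neq0$; its multiplicity $m$ is $\dim_{\mathbb C}\mathfrak g_\alpha$, and its square is $(\alpha,\alpha)$. A root is real if some element of the Weyl group (generated by the reflections $r_i(\lambda)=\lambda-(\lambda,\alpha_i)\alpha_i$) maps it to a simple root. The singleton count $s$ and the doubleton count $d$ of $(n_1,\dots,n_{10})$ are the numbers of $i$ with $n_i=1$ and with $n_i=2$. **Theorem.** (a) The real roots of $E_{10}$ with singleton count $s\ge2$ are exactly the permutations of the following fifteen vectors. All of these have square $2$ and multiplicity $1$, and their singleton and doubleton counts are as listed. 1. $(0,0,0,0,0,0,0,1,1,1)$, $s=3$, $d=0$ 2. $(0,0,0,0,1,1,1,1,1,1)$, $s=6$, $d=0$ 3. $(0,0,1,1,1,1,1,1,1,2)$, $s=7$, $d=1$ 4. $(0,1,1,1,1,1,1,2,2,2)$, $s=6$, $d=3$ 5. $(0,1,1,1,2,2,2,2,2,2)$, $s=3$, $d=6$ 6. $(1,1,1,1,1,1,1,1,1,3)$, $s=9$, $d=0$ 7. $(1,1,1,1,1,1,2,2,2,3)$, $s=6$, $d=3$ 8.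 $(1,1,1,1,2,2,2,2,3,3)$, $s=4$, $d=4$ 9. $(1,1,1,2,2,2,3,3,3,3)$, $s=3$, $d=3$ 10. $(1,1,1,3,3,3,3,3,3,3)$, $s=3$, $d=0$ 11. $(1,1,2,2,2,2,2,2,3,4)$, $s=2$, $d=6$ 12. $(1,1,2,2,2,3,3,3,3,4)$, $s=2$, $d=3$ 13. $(1,1,2,3,3,3,3,3,4,4)$, $s=2$, $d=1$ 14. $(1,1,3,3,3,3,4,4,4,4)$, $s=2$, $d=0$ 15. $(1,1,3,4,4,4,4,4,4,4)$, $s=2$, $d=0$ (b) Attach to $n\in\mathbb R^{10}$ the formal action $\mathcal A_n=2\pi\prod_{i=1}^{10}(M_pR_i)^{n_i}$, and its type-IIA form on the tenth direction $2\pi g_s^{-m_0}\prod_{i=1}^{9}(M_sl_i)^{n_i}$, where $m_0=-n_{10}+\frac13\sum_{i=1}^{10}n_i$ (all of $M_p,R_i,g_s,M_s,l_i$ are positive real variables). Then vector 1 is the unique $n$ whose $\mathcal A_n$ is the M2-brane action $2\pi M_p^3R_8R_9R_{10}$; vector 2 the unique $n$ whose $\mathcal A_n$ is the M5-brane action $2\pi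 M_p^6R_5\cdots R_{10}$; vector 3 the unique $n$ whose $\mathcal A_n$ is the Kaluza--Klein monopole action $2\pi M_p^9R_3\cdots R_9R_{10}^2$; and vector 6 the unique $n$ whose type-IIA form is the D8-brane action $2\pi g_s^{-1}M_s^9\,l_1\cdots l_9$. (c) There are infinitely many real roots with singleton count $s=1$. -/

import Mathlib

noncomputable section

namespace E10

/-- The Cartan matrix of `E₁₀`. The Dynkin diagram is a chain of the nodes `0, 1, …, 8`
(usually labelled `-1, 0, …, 7`) together with one more node `9` (usually labelled `8`) joined
to the node `6` (usually labelled `5`). -/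
def cartanMatrix : Matrix (Fin 10) (Fin 10) ℤ :=
  !![ 2, -1,  0,  0,  0,  0,  0,  0,  0,  0;
     -1,  2, -1,  0,  0,  0,  0,  0,  0,  0;
      0, -1,  2, -1,  0,  0,  0,  0,  0,  0;
      0,  0, -1,  2, -1,  0,  0,  0,  0,  0;
      0,  0,  0, -1,  2, -1,  0,  0,  0,  0;
      0,  0,  0,  0, -1,  2, -1,  0,  0,  0;
      0,  0,  0,  0,  0, -1,  2, -1,  0, -1;
      0,  0,  0,  0,  0,  0, -1,  2, -1,  0;
      0,  0,  0,  0,  0,  0,  0, -1,  2,  0;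
      0,  0,  0,  0,  0,  0, -1,  0,  0,  2]

/-- The Kac-Moody Lie algebra `E₁₀` over `ℂ`: generators `H i`, `E i`, `F i` (`i : Fin 10`)
with the Chevalley-Serre relations of the Cartan matrix. Since the Cartan matrix is invertible,
the coroots `H i` span the whole Cartan subalgebra. -/
abbrev Algebra : Type := Matrix.ToLieAlgebra ℂ cartanMatrix

/-- The simple coroots, as elements of the Lie algebra `E₁₀`. -/
def coroot (i : Fin 10) : Algebra :=
  LieSubmodule.Quotient.mk (N := CartanMatrix.Relations.toIdeal ℂ cartanMatrix)
    (FreeLieAlgebra.of ℂ (CartanMatrix.Generators.H i))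

/-- The dual of the (real) Cartan subalgebra, in the physical basis. -/
abbrev Weight : Type := Fin 10 → ℝ

/-- The simple roots in the physical basis:
`(1,-1,0,…,0), (0,1,-1,0,…,0), …, (0,…,0,1,-1), (0,…,0,1,1,1)`. -/
def simpleRoot : Fin 10 → Weight :=
  ![![1, -1, 0, 0, 0, 0, 0, 0, 0, 0],
    ![0, 1, -1, 0, 0, 0, 0, 0, 0, 0],
    ![0, 0, 1, -1, 0, 0, 0, 0, 0, 0],
    ![0, 0, 0, 1, -1, 0, 0, 0, 0, 0],
    ![0, 0, 0, 0, 1, -1, 0, 0, 0, 0],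
    ![0, 0, 0, 0, 0, 1, -1, 0, 0, 0],
    ![0, 0, 0, 0, 0, 0, 1, -1, 0, 0],
    ![0, 0, 0, 0, 0, 0, 0, 1, -1, 0],
    ![0, 0, 0, 0, 0, 0, 0, 0, 1, -1],
    ![0, 0, 0, 0, 0, 0, 0, 1, 1, 1]]

/-- The Cartan inner product in the physical basis,
`(n, n') = ∑ i, n i * n' i - (1/9) * (∑ i, n i) * (∑ i, n' i)`. -/
def form : LinearMap.BilinForm ℝ Weight :=
  LinearMap.mk₂ ℝ
    (fun n n' => ∑ i, n i * n' i - (1 / 9) * (∑ i, n i) * (∑ i, n' i))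
    (by intro a b c; simp only [Pi.add_apply, add_mul, Finset.sum_add_distrib]; ring)
    (by intro r a b
        simp only [Pi.smul_apply, smul_eq_mul, mul_assoc, ← Finset.mul_sum]; ring)
    (by intro a b c; simp only [Pi.add_apply, mul_add, Finset.sum_add_distrib]; ring)
    (by intro r a b
        simp only [Pi.smul_apply, smul_eq_mul, mul_left_comm _ r, ← Finset.mul_sum]; ring)

theorem form_apply (n n' : Weight) :
    form n n' = ∑ i, n i * n' i - (1 / 9) * (∑ i, n i) * (∑ i, n' i) := rfl

/-- The Gram matrix of the simple roots is the Cartan matrix. -/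
theorem form_simpleRoot (i j : Fin 10) :
    form (simpleRoot i) (simpleRoot j) = (cartanMatrix i j : ℝ) := by
  fin_cases i <;> fin_cases j <;>
    simp [form_apply, simpleRoot, cartanMatrix, Fin.sum_univ_succ] <;> norm_num

theorem form_simpleRoot_self (i : Fin 10) :
    form (simpleRoot i) (simpleRoot i) = 2 := by
  rw [form_simpleRoot]
  fin_cases i <;> simp [cartanMatrix]

/-- The root space `{x | ⁅h, x⁆ = α(h) x for all h in the Cartan subalgebra}` of a weight `α`;
it is enough to let `h` run over the simple coroots, on which `α` takes the values
`(α, αᵢ)`. -/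
def rootSpace (α : Weight) : Submodule ℂ Algebra where
  carrier := {x | ∀ i, ⁅coroot i, x⁆ = ((form α (simpleRoot i) : ℝ) : ℂ) • x}
  add_mem' := by
    intro a b ha hb i
    rw [lie_add, ha i, hb i, smul_add]
  zero_mem' := by
    intro i
    simp
  smul_mem' := by
    intro c x hx i
    rw [lie_smul, hx i, smul_comm]

/-- The roots of `E₁₀`. -/
def IsRoot (α : Weight) : Prop := α ≠ 0 ∧ rootSpace α ≠ ⊥

/-- The multiplicity of a root: the dimension of its root space. -/
def mult (α : Weight) : ℕ := Module.finrank ℂ (rootSpace α)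

/-- The simple reflection `λ ↦ λ - (αᵢ, λ) αᵢ`. -/
def simpleReflection (i : Fin 10) : Weight ≃ₗ[ℝ] Weight :=
  Module.reflection (form_simpleRoot_self i)

/-- The Weyl group of `E₁₀`. -/
def weylGroup : Subgroup (Weight ≃ₗ[ℝ] Weight) :=
  Subgroup.closure (Set.range simpleReflection)

/-- A root is real if it is equivalent to a simple root under the Weyl group. -/
def IsRealRoot (α : Weight) : Prop :=
  IsRoot α ∧ ∃ w ∈ weylGroup, ∃ i, w α = simpleRoot i

/-- The number of coordinates equal to `1`. -/
def singletonCount (α : Weight) : ℕ := (Finset.univ.filter fun i => α i = 1).card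

/-- The number of coordinates equal to `2`. -/
def doubletonCount (α : Weight) : ℕ := (Finset.univ.filter fun i => α i = 2).card

/-- The formal action `2π ∏ i, (M_p R_i) ^ n_i` on a ten-torus with radii `R_i`. -/
def action (n : Weight) (Mp : ℝ) (R : Fin 10 → ℝ) : ℝ :=
  2 * Real.pi * ∏ i, (Mp * R i) ^ n i

/-- The same action after reduction to type IIA on the last direction:
`2π gₛ ^ (-m₀) ∏ i, (M_s l_i) ^ m_i` with `m₀ = -n₁₀ + (1/3) ∑ n_i` and `m_i = n_i` for the
first nine directions. -/
def actionIIA (n : Weight) (gs Ms : ℝ) (l : Fin 9 → ℝ) : ℝ :=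
  2 * Real.pi * gs ^ (-(-n 9 + (1 / 3) * ∑ i, n i)) * ∏ i : Fin 9, (Ms * l i) ^ n i.castSucc

/-- `n` has the action of an M2-brane instanton wrapping the last three directions. -/
def IsM2BraneRoot (n : Weight) : Prop :=
  ∀ (Mp : ℝ) (R : Fin 10 → ℝ), 0 < Mp → (∀ i, 0 < R i) →
    action n Mp R = 2 * Real.pi * Mp ^ 3 * (R 7 * R 8 * R 9)

/-- `n` has the action of an M5-brane instanton wrapping the last six directions. -/
def IsM5BraneRoot (n : Weight) : Prop :=
  ∀ (Mp : ℝ) (R : Fin 10 → ℝ), 0 < Mp → (∀ i, 0 < R i) →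
    action n Mp R = 2 * Real.pi * Mp ^ 6 * (R 4 * R 5 * R 6 * R 7 * R 8 * R 9)

/-- `n` has the action of a Kaluza-Klein monopole instanton wrapping the third to ninth
directions, with the tenth direction as its special circle. -/
def IsKKMonopoleRoot (n : Weight) : Prop :=
  ∀ (Mp : ℝ) (R : Fin 10 → ℝ), 0 < Mp → (∀ i, 0 < R i) →
    action n Mp R =
      2 * Real.pi * Mp ^ 9 * (R 2 * R 3 * R 4 * R 5 * R 6 * R 7 * R 8 * R 9 ^ 2)

/-- After reduction to type IIA on the tenth direction, `n` has the action of a D8-brane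
instanton wrapping the nine remaining directions. -/
def IsD8BraneRoot (n : Weight) : Prop :=
  ∀ (gs Ms : ℝ) (l : Fin 9 → ℝ), 0 < gs → 0 < Ms → (∀ i, 0 < l i) →
    actionIIA n gs Ms l = 2 * Real.pi / gs * Ms ^ 9 * ∏ i, l i

/-- The fifteen listed vectors. -/
def table : Fin 15 → Weight :=
  ![![0, 0, 0, 0, 0, 0, 0, 1, 1, 1],
    ![0, 0, 0, 0, 1, 1, 1, 1, 1, 1],
    ![0, 0, 1, 1, 1, 1, 1, 1, 1, 2],
    ![0, 1, 1, 1, 1, 1, 1, 2, 2, 2],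
    ![0, 1, 1, 1, 2, 2, 2, 2, 2, 2],
    ![1, 1, 1, 1, 1, 1, 1, 1, 1, 3],
    ![1, 1, 1, 1, 1, 1, 2, 2, 2, 3],
    ![1, 1, 1, 1, 2, 2, 2, 2, 3, 3],
    ![1, 1, 1, 2, 2, 2, 3, 3, 3, 3],
    ![1, 1, 1, 3, 3, 3, 3, 3, 3, 3],
    ![1, 1, 2, 2, 2, 2, 2, 2, 3, 4],
    ![1, 1, 2, 2, 2, 3, 3, 3, 3, 4],
    ![1, 1, 2, 3, 3, 3, 3, 3, 4, 4],
    ![1, 1, 3, 3, 3, 3, 4, 4, 4, 4],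
    ![1, 1, 3, 4, 4, 4, 4, 4, 4, 4]]

/-- The listed singleton counts. -/
def tableSingleton : Fin 15 → ℕ := ![3, 6, 7, 6, 3, 9, 6, 4, 3, 3, 2, 2, 2, 2, 2]

/-- The listed doubleton counts. -/
def tableDoubleton : Fin 15 → ℕ := ![0, 0, 1, 3, 6, 0, 3, 4, 3, 0, 6, 3, 1, 0, 0]

end E10

end

/-! The proof has a Lie-theoretic half and an arithmetic half, joined by the Weyl orbit of the
simple roots, `realVectors`.

Lie theory: every vector of the orbit is a root of multiplicity one. The operators ad(e_i) and
ad(f_i) are locally nilpotent, and `sl₂` theory then makes a power of one of them inject a root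
space into the root space of the reflected weight, so multiplicities are Weyl invariant
(`rank_rootSpace_simpleReflection`). For a simple root the root space is at most the line of e_i, by
a grading argument (`rootSpace_simpleRoot_le`). It is exactly that line because e_i survives in the
algebra presented by the Serre relations: e_i acts nontrivially on an irreducible quotient of a
Verma-type module (`posGen_ne_zero`). Being a real root thus reduces to lying in the orbit
(`isRealRoot_iff`).

Arithmetic: orbit vectors are integral, have coordinate sum 3l and square 2, so their squares sum to
l² + 2. If two coordinates equal 1, the other eight have sum 3l - 2 and square sum l², and
Cauchy-Schwarz confines l to 1, ..., 11 and every coordinate to 0, ..., 4. A finite search over the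
numbers of coordinates with each value leaves the fifteen vectors (`exists_perm_table`). Conversely,
the nine chain reflections generate the coordinate permutations, and the last reflection sends each
listed vector except vector 1 to a permutation of an earlier one, so all lie in the orbit
(`table_mem_realVectors`).

Infinitude for s = 1 comes from the translations of an affine subgroup of the Weyl group
(`translates`). The brane identifications hold because an action, as a function of the radii and
couplings, determines its exponents. -/

noncomputable section

namespace E10

/-! ### Representations of sl₂ without finite-dimensionality -/

section SlTwo

open Polynomial

variable {V : Type*} [AddCommGroup V] [Module ℂ V]

/-- The commutation relations of an `sl₂`-triple of endomorphisms. -/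
structure SlTwoTriple (h e f : Module.End ℂ V) : Prop where
  e_f : ∀ x, e (f x) = f (e x) + h x
  h_e : ∀ x, h (e x) = e (h x) + (2 : ℂ) • e x
  h_f : ∀ x, h (f x) = f (h x) - (2 : ℂ) • f x

namespace SlTwoTriple

variable {h e f : Module.End ℂ V}

theorem symm (t : SlTwoTriple h e f) : SlTwoTriple (-h) f e where
  e_f x := by rw [t.e_f, LinearMap.neg_apply]; abel
  h_e x := by
    rw [LinearMap.neg_apply, LinearMap.neg_apply, t.h_f, map_neg]; abel
  h_f x := by
    rw [LinearMap.neg_apply, LinearMap.neg_apply, t.h_e, map_neg]; abel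

theorem f_e_pow_apply (t : SlTwoTriple h e f) (n : ℕ) (m : ℂ) (x : V) (hx : h x = m • x) :
    f (e ((e ^ n) x)) = (e ^ n) (f (e x)) - ((n : ℂ) * (m + n + 1)) • (e ^ n) x := by
  induction n generalizing m x with
  | zero => simp
  | succ n ih =>
    have h1 : h (e x) = (m + 2) • e x := by rw [t.h_e, hx, map_smul, add_smul]
    have h2 : f (e (e x)) = e (f (e x)) - (m + 2) • e x := by
      rw [← h1, t.e_f (e x)]; abel
    have h3 := ih (m + 2) (e x) h1
    rw [pow_succ, Module.End.mul_apply, Module.End.mul_apply, h3, h2, map_sub, map_smul, sub_sub,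
      ← add_smul]
    congr 2
    push_cast
    ring

theorem h_e_f (t : SlTwoTriple h e f) (m : ℂ) (x : V) (hx : h x = m • x) :
    h (e (f x)) = m • e (f x) := by
  rw [t.h_e, t.h_f, hx, map_sub, map_smul, map_smul, map_smul]
  abel

/-- The operator `e * f` preserves each weight space. Commuting the innermost `e` past `f ^ n`
replaces `x` by another vector `y` of the same weight, namely `x` acted on by a linear factor in `e
* f`, and induction applies to `y`. -/
theorem e_pow_f_pow_apply (t : SlTwoTriple h e f) (n : ℕ) (m : ℂ) (x : V) (hx : h x = m • x) :
    (e ^ n) ((f ^ n) x) =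
      aeval (e * f) (∏ k ∈ Finset.range n, (X - C ((k : ℂ) * (k + 1 - m)))) x := by
  induction n generalizing x with
  | zero => simp
  | succ n ih =>
    have h1 := t.symm.f_e_pow_apply n (-m) x (by rw [LinearMap.neg_apply, hx, neg_smul])
    set y : V := e (f x) - ((n : ℂ) * (n + 1 - m)) • x with hy
    have h2 : h y = m • y := by
      rw [hy, map_sub, map_smul, t.h_e_f m x hx, hx, smul_sub, smul_comm m]
    have h3 : e (f ((f ^ n) x)) = (f ^ n) y := by
      rw [h1, hy, map_sub, map_smul]
      congr 2
      ring
    rw [pow_succ e, Module.End.mul_apply, pow_succ' f, Module.End.mul_apply, h3, ih y h2,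
      Finset.prod_range_succ, map_mul, Module.End.mul_apply]
    congr 1
    rw [map_sub, aeval_X, aeval_C]
    rfl

theorem f_pow_e_pow_apply (t : SlTwoTriple h e f) (n : ℕ) (m : ℂ) (x : V) (hx : h x = m • x) :
    (f ^ n) ((e ^ n) x) =
      aeval (e * f) (∏ k ∈ Finset.range n, (X - C (((k : ℂ) + 1) * (k + m)))) x := by
  induction n generalizing x with
  | zero => simp
  | succ n ih =>
    have h1 := t.f_e_pow_apply n m x hx
    set y : V := e (f x) - (((n : ℂ) + 1) * (n + m)) • x with hy
    have h2 : h y = m • y := by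
      rw [hy, map_sub, map_smul, t.h_e_f m x hx, hx, smul_sub, smul_comm m]
    have h3 : f (e ((e ^ n) x)) = (e ^ n) y := by
      rw [h1, hy, t.e_f, hx, ← map_smul, ← map_sub]
      congr 1
      module
    rw [pow_succ f, Module.End.mul_apply, pow_succ' e, Module.End.mul_apply, h3, ih y h2,
      Finset.prod_range_succ, map_mul, Module.End.mul_apply]
    congr 1
    rw [map_sub, aeval_X, aeval_C]
    rfl

/-- If `e` is locally nilpotent, then `f ^ m` is injective on the weight space of weight `m`. -/
theorem eq_zero_of_f_pow_eq_zero (t : SlTwoTriple h e f) (m : ℕ) (x : V)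
    (hx : h x = (m : ℂ) • x) (n : ℕ) (hn : (e ^ n) x = 0) (hm : (f ^ m) x = 0) : x = 0 := by
  have h1 := t.e_pow_f_pow_apply m m x hx
  have h2 := t.f_pow_e_pow_apply n m x hx
  rw [hm, map_zero] at h1
  rw [hn, map_zero] at h2
  refine Submodule.disjoint_def.1 (disjoint_ker_aeval_of_isCoprime (e * f) ?_) x h1.symm h2.symm
  -- The vector `x` is killed by two polynomials in `e * f`. The roots j(j + 1 - m) of the first are
  -- nonpositive because j < m; the roots (k + 1)(k + m) of the second are positive because j < m
  -- forces m > 0. Hence the polynomials are coprime.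
  refine IsCoprime.prod_left fun j hj => IsCoprime.prod_right fun k _ => ?_
  refine isCoprime_X_sub_C_of_isUnit_sub ?_
  rw [isUnit_iff_ne_zero, sub_ne_zero]
  intro h
  have hj' := Finset.mem_range.1 hj
  have h' : (j : ℤ) * (j + 1 - m) = (k + 1) * (k + m) := by exact_mod_cast h
  have h3 : (j : ℤ) * (j + 1 - m) ≤ 0 :=
    mul_nonpos_of_nonneg_of_nonpos (by positivity) (by omega)
  have h4 : (0 : ℤ) < (k + 1) * (k + m) := mul_pos (by positivity) (by omega)
  omega

end SlTwoTriple

end SlTwo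

/-! ### Chevalley relations and local nilpotency in E₁₀ -/

section Presentation

open CartanMatrix FreeLieAlgebra

/-- The free Lie algebra on the Chevalley generators. -/
abbrev FreeAlg : Type := FreeLieAlgebra ℂ (Generators (Fin 10))

/-- The quotient map from the free Lie algebra on the Chevalley generators. -/
def proj : FreeAlg →ₗ⁅ℂ⁆ Algebra where
  toFun x := LieSubmodule.Quotient.mk (N := Relations.toIdeal ℂ cartanMatrix) x
  map_add' _ _ := rfl
  map_smul' _ _ := rfl
  map_lie' := rfl

theorem proj_surjective : Function.Surjective proj :=
  fun x => LieSubmodule.Quotient.surjective_mk' _ x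

theorem proj_eq_zero_iff (x : FreeAlg) : proj x = 0 ↔ x ∈ Relations.toIdeal ℂ cartanMatrix :=
  LieSubmodule.Quotient.mk_eq_zero'

theorem proj_eq_zero {x : FreeAlg} (hx : x ∈ Relations.toSet ℂ cartanMatrix) : proj x = 0 :=
  (proj_eq_zero_iff x).2 (LieSubmodule.subset_lieSpan hx)

/-- The positive Chevalley generators. -/
def posGen (i : Fin 10) : Algebra := proj (of ℂ (Generators.E i))

/-- The negative Chevalley generators. -/
def negGen (i : Fin 10) : Algebra := proj (of ℂ (Generators.F i))

theorem proj_of_H (i : Fin 10) : proj (of ℂ (Generators.H i)) = coroot i := rfl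

theorem lie_coroot_coroot (i j : Fin 10) : ⁅coroot i, coroot j⁆ = 0 := by
  have h : proj (Relations.HH ℂ (i, j)) = 0 := proj_eq_zero (by simp [Relations.toSet])
  simpa [Relations.HH, proj_of_H] using h

theorem lie_posGen_negGen (i j : Fin 10) :
    ⁅posGen i, negGen j⁆ = if i = j then coroot i else 0 := by
  have h : proj (Relations.EF ℂ (i, j)) = 0 := proj_eq_zero (by simp [Relations.toSet])
  split_ifs with hij
  · subst hij
    simpa [Relations.EF, proj_of_H, posGen, negGen, sub_eq_zero] using h
  · simpa [Relations.EF, hij, posGen, negGen] using h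

theorem lie_coroot_posGen (i j : Fin 10) :
    ⁅coroot i, posGen j⁆ = (cartanMatrix i j : ℂ) • posGen j := by
  have h : proj (Relations.HE ℂ cartanMatrix (i, j)) = 0 :=
    proj_eq_zero (by simp [Relations.toSet])
  rw [Int.cast_smul_eq_zsmul]
  simpa [Relations.HE, proj_of_H, posGen, sub_eq_zero] using h

theorem lie_coroot_negGen (i j : Fin 10) :
    ⁅coroot i, negGen j⁆ = -(cartanMatrix i j : ℂ) • negGen j := by
  have h : proj (Relations.HF ℂ cartanMatrix (i, j)) = 0 :=
    proj_eq_zero (by simp [Relations.toSet])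
  rw [neg_smul, Int.cast_smul_eq_zsmul]
  simpa [Relations.HF, proj_of_H, negGen, add_eq_zero_iff_eq_neg] using h

theorem proj_ad_pow (x y : FreeAlg) (n : ℕ) :
    proj (((LieAlgebra.ad ℂ FreeAlg x) ^ n) y) =
      ((LieAlgebra.ad ℂ Algebra (proj x)) ^ n) (proj y) := by
  induction n generalizing y with
  | zero => simp
  | succ n ih => simp [pow_succ, ih]

theorem ad_posGen_pow_posGen (i j : Fin 10) :
    ((LieAlgebra.ad ℂ Algebra (posGen i)) ^ ((-cartanMatrix i j).toNat + 1)) (posGen j) = 0 := by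
  have h : proj (Relations.adE ℂ cartanMatrix (i, j)) = 0 :=
    proj_eq_zero (by simp [Relations.toSet])
  rw [pow_succ]
  simpa [Relations.adE, proj_ad_pow, posGen] using h

theorem ad_negGen_pow_negGen (i j : Fin 10) :
    ((LieAlgebra.ad ℂ Algebra (negGen i)) ^ ((-cartanMatrix i j).toNat + 1)) (negGen j) = 0 := by
  have h : proj (Relations.adF ℂ cartanMatrix (i, j)) = 0 :=
    proj_eq_zero (by simp [Relations.toSet])
  rw [pow_succ]
  simpa [Relations.adF, proj_ad_pow, negGen] using h

theorem freeLieAlgebra_subalgebra_eq_top {R X : Type*} [CommRing R]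
    (K : LieSubalgebra R (FreeLieAlgebra R X)) (h : ∀ g, of R g ∈ K) : K = ⊤ := by
  let φ : FreeLieAlgebra R X →ₗ⁅R⁆ K := lift R fun g => ⟨of R g, h g⟩
  have hφ : K.incl.comp φ = LieHom.id := by
    apply hom_ext
    intro g
    simp [φ]
  rw [eq_top_iff]
  intro x _
  have hx : K.incl (φ x) = x := LieHom.congr_fun hφ x
  rw [← hx]
  exact (φ x).2

theorem subalgebra_eq_top (K : LieSubalgebra ℂ Algebra) (hh : ∀ i, coroot i ∈ K)
    (he : ∀ i, posGen i ∈ K) (hf : ∀ i, negGen i ∈ K) : K = ⊤ := by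
  have h : K.comap proj = ⊤ := freeLieAlgebra_subalgebra_eq_top _ fun g =>
    match g with
    | .H i => hh i
    | .E i => he i
    | .F i => hf i
  rw [eq_top_iff]
  intro x _
  obtain ⟨y, rfl⟩ := proj_surjective x
  have hy : y ∈ K.comap proj := h ▸ LieSubalgebra.mem_top y
  exact hy

theorem cartanMatrix_symm (i j : Fin 10) : cartanMatrix i j = cartanMatrix j i := by
  fin_cases i <;> fin_cases j <;> rfl

theorem cartanMatrix_self (i : Fin 10) : cartanMatrix i i = 2 := by
  fin_cases i <;> rfl

theorem cartanMatrix_off_diag (i j : Fin 10) (h : i ≠ j) :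
    cartanMatrix i j = 0 ∨ cartanMatrix i j = -1 := by
  fin_cases i <;> fin_cases j <;> first | exact absurd rfl h | exact Or.inl rfl | exact Or.inr rfl

theorem lie_posGen_coroot (i j : Fin 10) :
    ⁅posGen i, coroot j⁆ = -(cartanMatrix j i : ℂ) • posGen i := by
  rw [← lie_skew, lie_coroot_posGen, neg_smul]

theorem lie_negGen_coroot (i j : Fin 10) :
    ⁅negGen i, coroot j⁆ = (cartanMatrix j i : ℂ) • negGen i := by
  rw [← lie_skew, lie_coroot_negGen, neg_smul, neg_neg]

theorem lie_negGen_posGen (i j : Fin 10) :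
    ⁅negGen i, posGen j⁆ = if i = j then -coroot i else 0 := by
  rw [← lie_skew, lie_posGen_negGen]
  split_ifs with h1 h2 h2
  · rw [h1]
  · exact absurd h1.symm h2
  · exact absurd h2.symm h1
  · simp

/-- The elements killed by some power of ad(e_i) form a subalgebra, so local nilpotency need only be
checked on generators: the Serre relations give it on the e_j, and three brackets suffice on the
f_j. -/
theorem engel_posGen (i : Fin 10) : LieSubalgebra.engel ℂ (posGen i) = ⊤ := by
  refine subalgebra_eq_top _ (fun j => ?_) (fun j => ?_) (fun j => ?_) <;>
    rw [LieSubalgebra.mem_engel_iff]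
  · exact ⟨2, by simp [pow_succ, lie_posGen_coroot]⟩
  · exact ⟨_, ad_posGen_pow_posGen i j⟩
  · refine ⟨3, ?_⟩
    by_cases h : i = j <;> simp [pow_succ, lie_posGen_negGen, lie_posGen_coroot, h]

theorem engel_negGen (i : Fin 10) : LieSubalgebra.engel ℂ (negGen i) = ⊤ := by
  refine subalgebra_eq_top _ (fun j => ?_) (fun j => ?_) (fun j => ?_) <;>
    rw [LieSubalgebra.mem_engel_iff]
  · exact ⟨2, by simp [pow_succ, lie_negGen_coroot]⟩
  · refine ⟨3, ?_⟩
    by_cases h : i = j <;> simp [pow_succ, lie_negGen_posGen, lie_negGen_coroot, h]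
  · exact ⟨_, ad_negGen_pow_negGen i j⟩

theorem exists_ad_posGen_pow_eq_zero (i : Fin 10) (x : Algebra) :
    ∃ n : ℕ, ((LieAlgebra.ad ℂ Algebra (posGen i)) ^ n) x = 0 := by
  rw [← LieSubalgebra.mem_engel_iff, engel_posGen]
  trivial

theorem exists_ad_negGen_pow_eq_zero (i : Fin 10) (x : Algebra) :
    ∃ n : ℕ, ((LieAlgebra.ad ℂ Algebra (negGen i)) ^ n) x = 0 := by
  rw [← LieSubalgebra.mem_engel_iff, engel_negGen]
  trivial

theorem slTwoTriple (i : Fin 10) :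
    SlTwoTriple (LieAlgebra.ad ℂ Algebra (coroot i)) (LieAlgebra.ad ℂ Algebra (posGen i))
      (LieAlgebra.ad ℂ Algebra (negGen i)) where
  e_f x := by
    have h := lie_posGen_negGen i i
    rw [if_pos rfl] at h
    simp only [LieAlgebra.ad_apply]
    rw [leibniz_lie, h, add_comm]
  h_e x := by
    simp only [LieAlgebra.ad_apply]
    rw [leibniz_lie, lie_coroot_posGen, cartanMatrix_self, smul_lie, add_comm]
    norm_num
  h_f x := by
    simp only [LieAlgebra.ad_apply]
    rw [leibniz_lie, lie_coroot_negGen, cartanMatrix_self, smul_lie, neg_smul, add_comm,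
      sub_eq_add_neg]
    norm_num

end Presentation

/-! ### Weyl invariance of root multiplicities -/

section Reflection

theorem lie_posGen_mem {α : Weight} {x : Algebra} (hx : x ∈ rootSpace α) (j : Fin 10) :
    ⁅posGen j, x⁆ ∈ rootSpace (α + simpleRoot j) := by
  intro i
  rw [leibniz_lie, lie_coroot_posGen, hx i, smul_lie, lie_smul, ← add_smul, map_add,
    LinearMap.add_apply, form_simpleRoot, cartanMatrix_symm i j]
  push_cast
  rw [add_comm]

theorem lie_negGen_mem {α : Weight} {x : Algebra} (hx : x ∈ rootSpace α) (j : Fin 10) :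
    ⁅negGen j, x⁆ ∈ rootSpace (α - simpleRoot j) := by
  intro i
  rw [leibniz_lie, lie_coroot_negGen, hx i, smul_lie, lie_smul, ← add_smul, map_sub,
    LinearMap.sub_apply, form_simpleRoot, cartanMatrix_symm i j]
  push_cast
  rw [add_comm, sub_eq_add_neg]

theorem ad_posGen_pow_mem {α : Weight} {x : Algebra} (hx : x ∈ rootSpace α) (j : Fin 10) (n : ℕ) :
    ((LieAlgebra.ad ℂ Algebra (posGen j)) ^ n) x ∈ rootSpace (α + (n : ℝ) • simpleRoot j) := by
  induction n with
  | zero => simpa using hx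
  | succ n ih =>
    rw [pow_succ', Module.End.mul_apply]
    have := lie_posGen_mem ih j
    rw [Nat.cast_succ, add_smul, one_smul, ← add_assoc]
    exact this

theorem ad_negGen_pow_mem {α : Weight} {x : Algebra} (hx : x ∈ rootSpace α) (j : Fin 10) (n : ℕ) :
    ((LieAlgebra.ad ℂ Algebra (negGen j)) ^ n) x ∈ rootSpace (α - (n : ℝ) • simpleRoot j) := by
  induction n with
  | zero => simpa using hx
  | succ n ih =>
    rw [pow_succ', Module.End.mul_apply]
    have := lie_negGen_mem ih j
    rw [Nat.cast_succ, add_smul, one_smul, ← sub_sub]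
    exact this

theorem form_comm (a b : Weight) : form a b = form b a := by
  simp only [form_apply, mul_comm, mul_left_comm]

theorem simpleReflection_apply (i : Fin 10) (α : Weight) :
    simpleReflection i α = α - form α (simpleRoot i) • simpleRoot i := by
  rw [simpleReflection, Module.reflection_apply, form_comm]

theorem simpleReflection_simpleReflection (i : Fin 10) (α : Weight) :
    simpleReflection i (simpleReflection i α) = α :=
  Module.involutive_reflection (form_simpleRoot_self i) α

theorem form_simpleReflection (i : Fin 10) (a b : Weight) :
    form (simpleReflection i a) (simpleReflection i b) = form a b := by
  simp only [simpleReflection_apply, map_sub, LinearMap.sub_apply, map_smul, LinearMap.smul_apply,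
    smul_eq_mul, form_simpleRoot_self, form_comm (simpleRoot i)]
  ring

/-- For m ≥ 0 the map ad(f_i)^m is injective on the root space and lands in the reflected one; for m
≤ 0 the roles of e_i and f_i are exchanged. Cardinal ranks are used, so no root space has to be
known finite-dimensional; the involution later turns the inequality into an equality. -/
theorem rank_rootSpace_le (i : Fin 10) (α : Weight) (m : ℤ) (hm : form α (simpleRoot i) = m) :
    Module.rank ℂ (rootSpace α) ≤ Module.rank ℂ (rootSpace (simpleReflection i α)) := by
  obtain ⟨n, rfl | rfl⟩ := m.eq_nat_or_neg
  · have hα : simpleReflection i α = α - (n : ℝ) • simpleRoot i := by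
      rw [simpleReflection_apply, hm]; norm_num
    rw [hα]
    let g : rootSpace α →ₗ[ℂ] rootSpace (α - (n : ℝ) • simpleRoot i) :=
      ((LieAlgebra.ad ℂ Algebra (negGen i)) ^ n).restrict fun x hx => ad_negGen_pow_mem hx i n
    refine LinearMap.rank_le_of_injective g ?_
    rw [← LinearMap.ker_eq_bot, LinearMap.ker_eq_bot']
    rintro ⟨x, hx⟩ h
    obtain ⟨k, hk⟩ := exists_ad_posGen_pow_eq_zero i x
    refine Subtype.ext ((slTwoTriple i).eq_zero_of_f_pow_eq_zero n x ?_ k hk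
      (congrArg Subtype.val h))
    have := hx i
    rw [hm] at this
    simpa using this
  · have hα : simpleReflection i α = α + (n : ℝ) • simpleRoot i := by
      rw [simpleReflection_apply, hm]; push_cast; module
    rw [hα]
    let g : rootSpace α →ₗ[ℂ] rootSpace (α + (n : ℝ) • simpleRoot i) :=
      ((LieAlgebra.ad ℂ Algebra (posGen i)) ^ n).restrict fun x hx => ad_posGen_pow_mem hx i n
    refine LinearMap.rank_le_of_injective g ?_
    rw [← LinearMap.ker_eq_bot, LinearMap.ker_eq_bot']
    rintro ⟨x, hx⟩ h
    obtain ⟨k, hk⟩ := exists_ad_negGen_pow_eq_zero i x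
    refine Subtype.ext ((slTwoTriple i).symm.eq_zero_of_f_pow_eq_zero n x ?_ k hk
      (congrArg Subtype.val h))
    have := hx i
    rw [hm] at this
    simp [this]

theorem rank_rootSpace_simpleReflection (i : Fin 10) (α : Weight) (m : ℤ)
    (hm : form α (simpleRoot i) = m) :
    Module.rank ℂ (rootSpace (simpleReflection i α)) = Module.rank ℂ (rootSpace α) := by
  refine le_antisymm ?_ (rank_rootSpace_le i α m hm)
  have h : form (simpleReflection i α) (simpleRoot i) = ((-m : ℤ) : ℝ) := by
    rw [simpleReflection_apply, map_sub, LinearMap.sub_apply, map_smul, LinearMap.smul_apply,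
      form_simpleRoot_self, hm, smul_eq_mul]
    push_cast
    ring
  have h' := rank_rootSpace_le i _ (-m) h
  rwa [simpleReflection_simpleReflection] at h'

end Reflection

end E10

end

noncomputable section

namespace E10

/-! ### The root space of a simple root is at most a line -/

section UpperBound

/-- Iterated brackets of the elements `g i`, graded by the degrees `c i`. -/
inductive IteratedBracket (g : Fin 10 → Algebra) (c : Fin 10 → ℕ) : ℕ → Algebra → Prop
  | gen (i : Fin 10) : IteratedBracket g c (c i) (g i)
  | lie (i : Fin 10) {n : ℕ} {x : Algebra} (hx : IteratedBracket g c n x) :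
      IteratedBracket g c (c i + n) ⁅g i, x⁆

/-- The span of the Cartan subalgebra and of the iterated brackets of the elements `g i`. -/
def bracketSpan (g : Fin 10 → Algebra) (c : Fin 10 → ℕ) : Submodule ℂ Algebra :=
  Submodule.span ℂ (Set.range coroot ∪ {x | ∃ n, IteratedBracket g c n x})

variable {g p : Fin 10 → Algebra} {c : Fin 10 → ℕ}

theorem coroot_mem_bracketSpan (i : Fin 10) : coroot i ∈ bracketSpan g c :=
  Submodule.subset_span (Or.inl ⟨i, rfl⟩)

theorem IteratedBracket.mem_bracketSpan {n : ℕ} {x : Algebra} (hx : IteratedBracket g c n x) :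
    x ∈ bracketSpan g c :=
  Submodule.subset_span (Or.inr ⟨n, hx⟩)

theorem IteratedBracket.lie_eq {n : ℕ} {x D : Algebra} {s : ℂ} (hx : IteratedBracket g c n x)
    (hD : ∀ i, ⁅D, g i⁆ = (s * c i) • g i) : ⁅D, x⁆ = (s * n) • x := by
  induction hx with
  | gen i => exact hD i
  | lie i _ ih =>
    rw [leibniz_lie, hD, ih, smul_lie, lie_smul, ← add_smul]
    push_cast
    rw [mul_add]

theorem IteratedBracket.exists_lie_eq {n : ℕ} {x D : Algebra} {a : Fin 10 → ℂ}
    (hx : IteratedBracket g c n x) (hD : ∀ i, ⁅D, g i⁆ = a i • g i) : ∃ s : ℂ, ⁅D, x⁆ = s • x := by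
  induction hx with
  | gen i => exact ⟨_, hD i⟩
  | lie i _ ih =>
    obtain ⟨s, hs⟩ := ih
    exact ⟨a i + s, by rw [leibniz_lie, hD, hs, smul_lie, lie_smul, ← add_smul]⟩

theorem coroot_lie_mem_bracketSpan {a : Fin 10 → Fin 10 → ℂ}
    (hg : ∀ i j, ⁅coroot i, g j⁆ = a i j • g j) (i : Fin 10) {x : Algebra}
    (hx : x ∈ bracketSpan g c) : ⁅coroot i, x⁆ ∈ bracketSpan g c := by
  refine (Submodule.span_le (p := (bracketSpan g c).comap (LieAlgebra.ad ℂ Algebra (coroot i)))).2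
    ?_ hx
  rintro _ (⟨j, rfl⟩ | ⟨n, hn⟩)
  · simp [lie_coroot_coroot]
  · obtain ⟨s, hs⟩ := hn.exists_lie_eq (hg i)
    simpa [hs] using Submodule.smul_mem _ s hn.mem_bracketSpan

theorem gen_lie_mem_bracketSpan {a : Fin 10 → Fin 10 → ℂ}
    (hg : ∀ i j, ⁅coroot i, g j⁆ = a i j • g j) (i : Fin 10) {x : Algebra}
    (hx : x ∈ bracketSpan g c) : ⁅g i, x⁆ ∈ bracketSpan g c := by
  refine (Submodule.span_le (p := (bracketSpan g c).comap (LieAlgebra.ad ℂ Algebra (g i)))).2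
    ?_ hx
  rintro _ (⟨j, rfl⟩ | ⟨n, hn⟩)
  · have h : ⁅g i, coroot j⁆ = (-a j i) • g i := by rw [← lie_skew, hg, neg_smul]
    simpa [h] using Submodule.smul_mem _ (a j i) (IteratedBracket.gen i).mem_bracketSpan
  · exact (hn.lie i).mem_bracketSpan

/-- Induction through [p_i, [g_j, x]] = [[p_i, g_j], x] + [g_j, [p_i, x]]. The sign `t` is 1 when
`p` consists of the e_i and -1 when it consists of the f_i. -/
theorem opposite_lie_mem_bracketSpan {a : Fin 10 → Fin 10 → ℂ} {t : ℂ}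
    (hg : ∀ i j, ⁅coroot i, g j⁆ = a i j • g j)
    (hp : ∀ i j, ⁅p i, g j⁆ = if i = j then t • coroot i else 0) (i : Fin 10) {n : ℕ}
    {x : Algebra} (hx : IteratedBracket g c n x) : ⁅p i, x⁆ ∈ bracketSpan g c := by
  induction hx with
  | gen j =>
    rw [hp]
    split_ifs
    · exact Submodule.smul_mem _ _ (coroot_mem_bracketSpan i)
    · exact Submodule.zero_mem _
  | lie j hx ih =>
    rw [leibniz_lie, hp]
    refine Submodule.add_mem _ ?_ (gen_lie_mem_bracketSpan hg j ih)
    split_ifs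
    · rw [smul_lie]
      exact Submodule.smul_mem _ _ (coroot_lie_mem_bracketSpan hg i hx.mem_bracketSpan)
    · rw [zero_lie]
      exact Submodule.zero_mem _

/-- The elements whose adjoint action preserves `S` form a subalgebra containing the generators,
hence everything. Then `S` is an ideal, in particular a subalgebra, and it contains the generators
too. -/
theorem submodule_eq_top (S : Submodule ℂ Algebra) (hh : ∀ i, coroot i ∈ S)
    (he : ∀ i, posGen i ∈ S) (hf : ∀ i, negGen i ∈ S)
    (hh' : ∀ i, ∀ x ∈ S, ⁅coroot i, x⁆ ∈ S) (he' : ∀ i, ∀ x ∈ S, ⁅posGen i, x⁆ ∈ S)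
    (hf' : ∀ i, ∀ x ∈ S, ⁅negGen i, x⁆ ∈ S) : S = ⊤ := by
  let K : LieSubalgebra ℂ Algebra :=
    { carrier := {y | ∀ x ∈ S, ⁅y, x⁆ ∈ S}
      add_mem' := fun {a b} ha hb x hx => by
        rw [add_lie]; exact S.add_mem (ha x hx) (hb x hx)
      zero_mem' := fun x _ => by rw [zero_lie]; exact S.zero_mem
      smul_mem' := fun r a ha x hx => by rw [smul_lie]; exact S.smul_mem r (ha x hx)
      lie_mem' := fun {a b} ha hb x hx => by
        rw [lie_lie]; exact S.sub_mem (ha _ (hb x hx)) (hb _ (ha x hx)) }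
  have hK : K = ⊤ := subalgebra_eq_top K hh' he' hf'
  let K' : LieSubalgebra ℂ Algebra :=
    { S with
      lie_mem' := fun {a b} _ hb => by
        have ha : a ∈ K := hK ▸ LieSubalgebra.mem_top a
        exact ha b hb }
  have hK' : K' = ⊤ := subalgebra_eq_top K' hh he hf
  rw [eq_top_iff]
  intro x _
  have hx : x ∈ K' := hK' ▸ LieSubalgebra.mem_top x
  exact hx

theorem bracketSpan_sup_eq_top (c : Fin 10 → ℕ) :
    bracketSpan posGen c ⊔ bracketSpan negGen c = ⊤ := by
  have hep : ∀ i, ∀ x ∈ bracketSpan posGen c, ⁅posGen i, x⁆ ∈ bracketSpan posGen c :=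
    fun i x hx => gen_lie_mem_bracketSpan lie_coroot_posGen i hx
  have hfn : ∀ i, ∀ x ∈ bracketSpan negGen c, ⁅negGen i, x⁆ ∈ bracketSpan negGen c :=
    fun i x hx => gen_lie_mem_bracketSpan lie_coroot_negGen i hx
  have hen : ∀ i, ∀ x ∈ bracketSpan negGen c,
      ⁅posGen i, x⁆ ∈ bracketSpan posGen c ⊔ bracketSpan negGen c := by
    intro i x hx
    refine (Submodule.span_le (p := (bracketSpan posGen c ⊔ bracketSpan negGen c).comap
      (LieAlgebra.ad ℂ Algebra (posGen i)))).2 ?_ hx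
    rintro _ (⟨j, rfl⟩ | ⟨n, hn⟩)
    · exact Submodule.mem_sup_left (hep i _ (coroot_mem_bracketSpan j))
    · refine Submodule.mem_sup_right
        (opposite_lie_mem_bracketSpan (p := posGen) (t := 1) lie_coroot_negGen ?_ i hn)
      simpa using lie_posGen_negGen
  have hfp : ∀ i, ∀ x ∈ bracketSpan posGen c,
      ⁅negGen i, x⁆ ∈ bracketSpan posGen c ⊔ bracketSpan negGen c := by
    intro i x hx
    refine (Submodule.span_le (p := (bracketSpan posGen c ⊔ bracketSpan negGen c).comap
      (LieAlgebra.ad ℂ Algebra (negGen i)))).2 ?_ hx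
    rintro _ (⟨j, rfl⟩ | ⟨n, hn⟩)
    · exact Submodule.mem_sup_right (hfn i _ (coroot_mem_bracketSpan j))
    · refine Submodule.mem_sup_left
        (opposite_lie_mem_bracketSpan (p := negGen) (t := -1) lie_coroot_posGen ?_ i hn)
      simpa using lie_negGen_posGen
  refine submodule_eq_top _ (fun i => Submodule.mem_sup_left (coroot_mem_bracketSpan i))
    (fun i => Submodule.mem_sup_left (IteratedBracket.gen i).mem_bracketSpan)
    (fun i => Submodule.mem_sup_right (IteratedBracket.gen i).mem_bracketSpan) ?_ ?_ ?_
  all_goals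
    intro i x hx
    obtain ⟨y, hy, z, hz, rfl⟩ := Submodule.mem_sup.1 hx
    rw [lie_add]
  · exact Submodule.add_mem_sup (coroot_lie_mem_bracketSpan lie_coroot_posGen i hy)
      (coroot_lie_mem_bracketSpan lie_coroot_negGen i hz)
  · exact Submodule.add_mem _ (Submodule.mem_sup_left (hep i y hy)) (hen i z hz)
  · exact Submodule.add_mem _ (hfp i y hy) (Submodule.mem_sup_right (hfn i z hz))

/-- The inverse of the Cartan matrix. -/
def cartanInverse : Matrix (Fin 10) (Fin 10) ℤ :=
  !![0, -1, -2, -3, -4, -5, -6, -4, -2, -3;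
     -1, -2, -4, -6, -8, -10, -12, -8, -4, -6;
     -2, -4, -6, -9, -12, -15, -18, -12, -6, -9;
     -3, -6, -9, -12, -16, -20, -24, -16, -8, -12;
     -4, -8, -12, -16, -20, -25, -30, -20, -10, -15;
     -5, -10, -15, -20, -25, -30, -36, -24, -12, -18;
     -6, -12, -18, -24, -30, -36, -42, -28, -14, -21;
     -4, -8, -12, -16, -20, -24, -28, -18, -9, -14;
     -2, -4, -6, -8, -10, -12, -14, -9, -4, -7;
     -3, -6, -9, -12, -15, -18, -21, -14, -7, -10]

theorem cartanInverse_mul (i j : Fin 10) :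
    ∑ k, cartanInverse i k * cartanMatrix k j = if i = j then 1 else 0 := by
  fin_cases i <;> fin_cases j <;> rfl

/-- There is an element of the Cartan subalgebra on which the simple roots take prescribed
values. -/
theorem exists_coweight (c : Fin 10 → ℂ) :
    ∃ d : Fin 10 → ℂ, ∀ j, ∑ k, d k * cartanMatrix k j = c j := by
  refine ⟨fun k => ∑ l, c l * cartanInverse l k, fun j => ?_⟩
  simp only [Finset.sum_mul]
  rw [Finset.sum_comm]
  simp only [mul_assoc, ← Finset.mul_sum]
  have h : ∀ l, ∑ k, (cartanInverse l k : ℂ) * cartanMatrix k j = if l = j then 1 else 0 := by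
    intro l
    exact_mod_cast congrArg (Int.cast : ℤ → ℂ) (cartanInverse_mul l j)
  simp [h]

theorem rootSpace_simpleRoot_le (i : Fin 10) :
    rootSpace (simpleRoot i) ≤ Submodule.span ℂ {posGen i} := by
  -- With degree 1 at node `i` and 2 elsewhere, e_i is the only iterated bracket of degree 1.
  -- Invertibility of the Cartan matrix realises this degree as the eigenvalue of ad(D) for some D
  -- in the Cartan subalgebra.
  set c : Fin 10 → ℕ := fun j => if j = i then 1 else 2 with hc
  obtain ⟨d, hd⟩ := exists_coweight fun j => (c j : ℂ)
  set D : Algebra := ∑ k, d k • coroot k with hD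
  have hDe : ∀ j, ⁅D, posGen j⁆ = ((1 : ℂ) * c j) • posGen j := by
    intro j
    rw [hD, sum_lie]
    simp only [smul_lie, lie_coroot_posGen, smul_smul, ← Finset.sum_smul, hd, one_mul]
  have hDf : ∀ j, ⁅D, negGen j⁆ = ((-1 : ℂ) * c j) • negGen j := by
    intro j
    rw [hD, sum_lie]
    simp only [smul_lie, lie_coroot_negGen, smul_smul, ← Finset.sum_smul, hd, mul_neg,
      Finset.sum_neg_distrib, neg_mul, one_mul]
  have hDh : ∀ j, ⁅D, coroot j⁆ = 0 := by
    intro j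
    rw [hD, sum_lie]
    simp [lie_coroot_coroot]
  set T : Module.End ℂ Algebra := LieAlgebra.ad ℂ Algebra D with hT
  -- All other spanning elements have eigenvalue different from 1, so the algebra is the line of e_i
  -- plus `Y`. Independence of eigenspaces then kills the `Y`-component of an eigenvector of
  -- eigenvalue 1.
  set Y : Submodule ℂ Algebra := ⨆ μ ≠ (1 : ℂ), T.eigenspace μ with hY
  have hYmem : ∀ (μ : ℂ) (x : Algebra), μ ≠ 1 → ⁅D, x⁆ = μ • x → x ∈ Y := by
    intro μ x hμ hx
    exact Submodule.mem_iSup_of_mem μ (Submodule.mem_iSup_of_mem hμ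
      (Module.End.mem_eigenspace_iff.2 hx))
  have hYh : ∀ j, coroot j ∈ Y := fun j => hYmem 0 _ zero_ne_one (by rw [hDh, zero_smul])
  have hpos : ∀ n x, IteratedBracket posGen c n x → 1 ≤ n ∧ (n = 1 → x = posGen i) := by
    intro n x hx
    induction hx with
    | gen j =>
      by_cases hj : j = i <;> simp [hc, hj]
    | lie j _ ih =>
      have : 1 ≤ c j := by by_cases hj : j = i <;> simp [hc, hj]
      omega
  have htop : Submodule.span ℂ {posGen i} ⊔ Y = ⊤ := by
    rw [eq_top_iff, ← bracketSpan_sup_eq_top c, sup_le_iff]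
    constructor <;> refine Submodule.span_le.2 ?_ <;> rintro x (⟨j, rfl⟩ | ⟨n, hn⟩)
    · exact Submodule.mem_sup_right (hYh j)
    · by_cases h1 : n = 1
      · rw [(hpos n x hn).2 h1]
        exact Submodule.mem_sup_left (Submodule.mem_span_singleton_self _)
      · refine Submodule.mem_sup_right (hYmem _ x ?_ (hn.lie_eq hDe))
        rw [one_mul]
        exact_mod_cast h1
    · exact Submodule.mem_sup_right (hYh j)
    · refine Submodule.mem_sup_right (hYmem _ x ?_ (hn.lie_eq hDf))
      intro h
      have h' : (-1 : ℤ) * n = 1 := by exact_mod_cast h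
      omega
  intro x hx
  have hx1 : ⁅D, x⁆ = x := by
    have hx' : ∀ k, ⁅coroot k, x⁆ = (cartanMatrix k i : ℂ) • x := by
      intro k
      rw [hx k, form_simpleRoot, cartanMatrix_symm i k, Complex.ofReal_intCast]
    rw [hD, sum_lie]
    simp only [smul_lie, hx', smul_smul, ← Finset.sum_smul, hd]
    simp [hc]
  obtain ⟨y, hy, z, hz, hyz⟩ := Submodule.mem_sup.1 (htop ▸ Submodule.mem_top : x ∈ _)
  have hy1 : ⁅D, y⁆ = y := by
    obtain ⟨t, rfl⟩ := Submodule.mem_span_singleton.1 hy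
    rw [lie_smul, hDe]
    simp [hc]
  have hz1 : z ∈ T.eigenspace 1 := by
    rw [Module.End.mem_eigenspace_iff, one_smul]
    change ⁅D, z⁆ = z
    rw [eq_sub_of_add_eq' hyz, lie_sub, hx1, hy1]
  have hz0 : z = 0 := Submodule.disjoint_def.1 (T.eigenspaces_iSupIndep 1) z hz1 hz
  rw [← hyz, hz0, add_zero]
  exact hy

end UpperBound

end E10

end

noncomputable section

namespace E10

/-! ### Serre elements commute with the opposite generators -/

section Serre

variable {L : Type*} [LieRing L] [LieAlgebra ℂ L]

/-- Elements satisfying the Chevalley relations, with the Cartan matrix scaled by `t` in the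
relations of weights: `t = 1` is the usual convention, `t = -1` arises by exchanging `e` and `f`. -/
structure ChevalleyFamily (t : ℂ) (h e f : Fin 10 → L) : Prop where
  h_h : ∀ i j, ⁅h i, h j⁆ = 0
  e_f : ∀ i j, ⁅e i, f j⁆ = if i = j then h i else 0
  h_e : ∀ i j, ⁅h i, e j⁆ = (t * cartanMatrix i j) • e j
  h_f : ∀ i j, ⁅h i, f j⁆ = (-t * cartanMatrix i j) • f j

namespace ChevalleyFamily

variable {t : ℂ} {h e f : Fin 10 → L}

theorem symm (C : ChevalleyFamily t h e f) : ChevalleyFamily t (-h) f e where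
  h_h i j := by simp [C.h_h]
  e_f i j := by
    rw [← lie_skew, C.e_f]
    by_cases hij : i = j
    · simp [hij]
    · simp [hij, Ne.symm hij]
  h_e i j := by simp [C.h_f]
  h_f i j := by simp [C.h_e]

/-- The diagram is simply laced, so only the off-diagonal entries 0 and -1 occur and the commutator
is computed directly in each case. Through `symm` the same computation serves the Serre elements in
the f_i. -/
theorem lie_f_serre (C : ChevalleyFamily t h e f) (i j k : Fin 10) :
    ⁅f k, ((LieAlgebra.ad ℂ L (e i)) ^ (-cartanMatrix i j).toNat) ⁅e i, e j⁆⁆ = 0 := by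
  by_cases hij : i = j
  · subst hij
    rw [cartanMatrix_self, lie_self, map_zero, lie_zero]
  have hfe : ∀ i j, ⁅f i, e j⁆ = if i = j then -h i else 0 := C.symm.e_f
  have heh : ∀ i j, ⁅e i, h j⁆ = -(t * cartanMatrix j i) • e i := by
    intro i j
    rw [← lie_skew, C.h_e, neg_smul]
  have hlie : ⁅f k, ⁅e i, e j⁆⁆ =
      (if k = i then -(t * cartanMatrix i j) • e j else 0) +
        if k = j then (t * cartanMatrix i j) • e i else 0 := by
    rw [leibniz_lie, hfe, hfe]
    congr 1
    · split_ifs with hk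
      · rw [neg_lie, hk, C.h_e, neg_smul]
      · rw [zero_lie]
    · split_ifs with hk
      · rw [lie_neg, hk, heh, neg_smul, neg_neg, cartanMatrix_symm]
      · rw [lie_zero]
  rcases cartanMatrix_off_diag i j hij with ha | ha
  · rw [ha] at hlie ⊢
    simpa using hlie
  · rw [ha] at hlie ⊢
    have h1 : (-(-1 : ℤ)).toNat = 1 := rfl
    rw [h1, pow_one, LieAlgebra.ad_apply, leibniz_lie, hlie, hfe]
    by_cases hki : k = i
    · subst hki
      rw [if_pos rfl, if_pos rfl, if_neg hij, add_zero, neg_lie, leibniz_lie (h k), C.h_e, C.h_e,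
        ha, cartanMatrix_self, smul_lie, lie_smul, lie_smul]
      push_cast
      module
    · rw [if_neg hki, if_neg hki, zero_lie]
      split_ifs <;> simp

end ChevalleyFamily

end Serre

/-! ### A Verma-type module, showing that the e_i are nonzero -/

section Verma

attribute [local instance] LieRing.ofAssociativeRing

/-- The space spanned by the words in the negative generators, underlying a Verma module. -/
abbrev Words : Type := List (Fin 10) →₀ ℂ

/-- The weight of a word on a simple coroot. The highest weight is `1` on each of them. -/
def wordWeight (i : Fin 10) : List (Fin 10) → ℂ
  | [] => 1
  | j :: w => wordWeight i w - cartanMatrix i j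

/-- The action of the negative generators on words. -/
def lower (i : Fin 10) : Module.End ℂ Words := Finsupp.lmapDomain ℂ ℂ (List.cons i)

/-- The action of the simple coroots on words. -/
def diag (i : Fin 10) : Module.End ℂ Words :=
  Finsupp.linearCombination ℂ fun w => Finsupp.single w (wordWeight i w)

/-- The action of the positive generators on a basis word. -/
def raiseWord (i : Fin 10) : List (Fin 10) → Words
  | [] => 0
  | j :: w => lower j (raiseWord i w) + if i = j then Finsupp.single w (wordWeight i w) else 0

/-- The action of the positive generators on words. -/
def raise (i : Fin 10) : Module.End ℂ Words := Finsupp.linearCombination ℂ (raiseWord i)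

theorem lower_single (i : Fin 10) (w : List (Fin 10)) :
    lower i (Finsupp.single w 1) = Finsupp.single (i :: w) 1 := by
  simp [lower]

theorem diag_single (i : Fin 10) (w : List (Fin 10)) :
    diag i (Finsupp.single w 1) = wordWeight i w • Finsupp.single w 1 := by
  simp [diag]

theorem raise_single (i : Fin 10) (w : List (Fin 10)) :
    raise i (Finsupp.single w 1) = raiseWord i w := by
  simp [raise]

theorem raiseWord_cons (i j : Fin 10) (w : List (Fin 10)) :
    raiseWord i (j :: w) = lower j (raiseWord i w) +
      if i = j then wordWeight i w • Finsupp.single w 1 else 0 := by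
  simp [raiseWord]

theorem end_ext {a b : Module.End ℂ Words}
    (h : ∀ w, a (Finsupp.single w 1) = b (Finsupp.single w 1)) : a = b :=
  Finsupp.lhom_ext' fun w => LinearMap.ext_ring (h w)

theorem end_lie_apply (a b : Module.End ℂ Words) (x : Words) : ⁅a, b⁆ x = a (b x) - b (a x) :=
  rfl

theorem diag_lower (i j : Fin 10) :
    ⁅diag i, lower j⁆ = (-1 * cartanMatrix i j : ℂ) • lower j := by
  refine end_ext fun w => ?_
  simp only [end_lie_apply, lower_single, diag_single,
    map_smul, LinearMap.smul_apply, wordWeight]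
  module

theorem raise_lower (i j : Fin 10) :
    ⁅raise i, lower j⁆ = if i = j then diag i else 0 := by
  refine end_ext fun w => ?_
  simp only [end_lie_apply, lower_single, raise_single,
    raiseWord_cons, add_sub_cancel_left]
  split_ifs
  · rw [diag_single]
  · rfl

theorem diag_diag (i j : Fin 10) : ⁅diag i, diag j⁆ = 0 := by
  refine end_ext fun w => ?_
  simp only [end_lie_apply, diag_single, map_smul,
    LinearMap.zero_apply]
  module

theorem diag_raiseWord (i j : Fin 10) (w : List (Fin 10)) :
    diag i (raiseWord j w) = (wordWeight i w + cartanMatrix i j) • raiseWord j w := by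
  induction w with
  | nil => simp [raiseWord]
  | cons k w ih =>
    have h : diag i (lower k (raiseWord j w)) =
        lower k (diag i (raiseWord j w)) - (cartanMatrix i k : ℂ) • lower k (raiseWord j w) := by
      have := LinearMap.congr_fun (diag_lower i k) (raiseWord j w)
      simp only [end_lie_apply,
        LinearMap.smul_apply] at this
      rw [sub_eq_iff_eq_add.1 this]
      module
    rw [raiseWord_cons, map_add, h, ih, map_smul, wordWeight]
    split_ifs with hjk
    · subst hjk
      rw [map_smul, diag_single]
      module
    · rw [map_zero]
      module

theorem diag_raise (i j : Fin 10) :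
    ⁅diag i, raise j⁆ = (1 * cartanMatrix i j : ℂ) • raise j := by
  refine end_ext fun w => ?_
  simp only [end_lie_apply, raise_single, diag_single,
    map_smul, LinearMap.smul_apply, diag_raiseWord]
  module

theorem chevalleyFamily_words : ChevalleyFamily 1 diag raise lower where
  h_h := diag_diag
  e_f := raise_lower
  h_e := diag_raise
  h_f := diag_lower

/-- The coefficient of the empty word. -/
def vacuum : Words →ₗ[ℂ] ℂ := Finsupp.lapply []

theorem vacuum_lower (i : Fin 10) (x : Words) : vacuum (lower i x) = 0 := by
  have h : vacuum ∘ₗ lower i = 0 := by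
    refine Finsupp.lhom_ext' fun w => LinearMap.ext_ring ?_
    change vacuum (lower i (Finsupp.single w 1)) = 0
    rw [lower_single]
    simp [vacuum]
  exact LinearMap.congr_fun h x

theorem vacuum_diag (i : Fin 10) (x : Words) : vacuum (diag i x) = vacuum x := by
  have h : vacuum ∘ₗ diag i = vacuum := by
    refine Finsupp.lhom_ext' fun w => LinearMap.ext_ring ?_
    change vacuum (diag i (Finsupp.single w 1)) = vacuum (Finsupp.single w 1)
    rw [diag_single]
    cases w <;> simp [vacuum, wordWeight]
  exact LinearMap.congr_fun h x

/-- The successive action of positive generators. -/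
def raiseList : List (Fin 10) → Words →ₗ[ℂ] Words
  | [] => LinearMap.id
  | i :: w => raiseList w ∘ₗ raise i

/-- The largest submodule of the Verma module that does not meet its highest weight space. -/
def radical : Submodule ℂ Words := ⨅ w, (vacuum ∘ₗ raiseList w).ker

theorem mem_radical {x : Words} : x ∈ radical ↔ ∀ w, vacuum (raiseList w x) = 0 := by
  simp [radical]

theorem raise_mem_radical (i : Fin 10) {x : Words} (hx : x ∈ radical) : raise i x ∈ radical :=
  mem_radical.2 fun w => mem_radical.1 hx (i :: w)

theorem diag_mem_radical (i : Fin 10) {x : Words} (hx : x ∈ radical) : diag i x ∈ radical := by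
  refine mem_radical.2 fun w => ?_
  induction w generalizing x with
  | nil => exact (vacuum_diag i x).trans (mem_radical.1 hx [])
  | cons j w ih =>
    have h := LinearMap.congr_fun (diag_raise i j) x
    simp only [end_lie_apply,
      LinearMap.smul_apply] at h
    have hj := raise_mem_radical j hx
    rw [raiseList, LinearMap.comp_apply, ← sub_eq_of_eq_add (sub_eq_iff_eq_add'.1 h), map_sub,
      map_sub, ih hj, map_smul, map_smul, mem_radical.1 hj w, smul_zero, sub_zero]

theorem lower_mem_radical (i : Fin 10) {x : Words} (hx : x ∈ radical) : lower i x ∈ radical := by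
  refine mem_radical.2 fun w => ?_
  induction w generalizing x with
  | nil => exact vacuum_lower i x
  | cons j w ih =>
    have h := LinearMap.congr_fun (raise_lower j i) x
    simp only [end_lie_apply] at h
    rw [raiseList, LinearMap.comp_apply, sub_eq_iff_eq_add.1 h, map_add, map_add,
      ih (raise_mem_radical j hx), add_zero]
    split_ifs
    · exact mem_radical.1 (diag_mem_radical j hx) w
    · simp

/-- The lowering operators generate every word from the empty one. -/
theorem eq_zero_of_lie_lower_eq_zero (a : Module.End ℂ Words) (h : ∀ i, ⁅lower i, a⁆ = 0)
    (h0 : a (Finsupp.single [] 1) = 0) : a = 0 := by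
  refine end_ext fun w => ?_
  induction w with
  | nil => exact h0
  | cons i w ih =>
    have h' := LinearMap.congr_fun (h i) (Finsupp.single w 1)
    simp only [end_lie_apply, LinearMap.zero_apply,
      lower_single] at h'
    rw [← sub_eq_zero.1 h', ih, LinearMap.zero_apply, map_zero]
    rfl

/-- Dual to the previous lemma: `a` can be moved to the left of all raising operators, where its
vacuum coefficient vanishes. -/
theorem apply_mem_radical_of_lie_raise_eq_zero (a : Module.End ℂ Words)
    (h : ∀ i, ⁅raise i, a⁆ = 0) (h0 : ∀ x, vacuum (a x) = 0) (x : Words) : a x ∈ radical := by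
  refine mem_radical.2 fun w => ?_
  induction w generalizing x with
  | nil => exact h0 x
  | cons i w ih =>
    have h' := LinearMap.congr_fun (h i) x
    simp only [end_lie_apply, LinearMap.zero_apply] at h'
    rw [raiseList, LinearMap.comp_apply, sub_eq_zero.1 h', ih]

theorem serre_raise_eq_zero (i j : Fin 10) :
    ((LieAlgebra.ad ℂ (Module.End ℂ Words) (raise i)) ^ (-cartanMatrix i j).toNat)
      ⁅raise i, raise j⁆ = 0 := by
  refine eq_zero_of_lie_lower_eq_zero _ (chevalleyFamily_words.lie_f_serre i j) ?_
  have h : ∀ k, raise k (Finsupp.single [] 1) = 0 := fun k => raise_single k []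
  generalize (-cartanMatrix i j).toNat = n
  induction n with
  | zero => simp [h]
  | succ n ih =>
    rw [pow_succ', Module.End.mul_apply, LieAlgebra.ad_apply, end_lie_apply, ih, h, map_zero, map_zero, sub_zero]

/-- Words are free in the lowering operators, so these Serre elements need not act by zero as those
in `raise` do. They vanish only modulo the radical, which is why the quotient is needed. -/
theorem serre_lower_mem_radical (i j : Fin 10) (x : Words) :
    ((LieAlgebra.ad ℂ (Module.End ℂ Words) (lower i)) ^ (-cartanMatrix i j).toNat)
      ⁅lower i, lower j⁆ x ∈ radical := by
  refine apply_mem_radical_of_lie_raise_eq_zero _ (chevalleyFamily_words.symm.lie_f_serre i j)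
    ?_ x
  generalize (-cartanMatrix i j).toNat = n
  induction n with
  | zero => simp [end_lie_apply, vacuum_lower]
  | succ n ih =>
    intro x
    rw [pow_succ', Module.End.mul_apply, LieAlgebra.ad_apply, end_lie_apply, map_sub, vacuum_lower, ih, sub_zero]

open CartanMatrix FreeLieAlgebra

/-- The action of the free Lie algebra on the Chevalley generators on the Verma module. -/
def wordsAction : FreeAlg →ₗ⁅ℂ⁆ Module.End ℂ Words :=
  lift ℂ fun g =>
    match g with
    | .H i => diag i
    | .E i => raise i
    | .F i => lower i

theorem wordsAction_H (i : Fin 10) : wordsAction (of ℂ (Generators.H i)) = diag i := by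
  simp [wordsAction]

theorem wordsAction_E (i : Fin 10) : wordsAction (of ℂ (Generators.E i)) = raise i := by
  simp [wordsAction]

theorem wordsAction_F (i : Fin 10) : wordsAction (of ℂ (Generators.F i)) = lower i := by
  simp [wordsAction]

theorem wordsAction_ad_pow (x y : FreeAlg) (n : ℕ) :
    wordsAction (((LieAlgebra.ad ℂ FreeAlg x) ^ n) y) =
      ((LieAlgebra.ad ℂ (Module.End ℂ Words) (wordsAction x)) ^ n) (wordsAction y) := by
  induction n generalizing y with
  | zero => simp
  | succ n ih =>
    rw [pow_succ, pow_succ, Module.End.mul_apply, Module.End.mul_apply, ih, LieAlgebra.ad_apply,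
      LieAlgebra.ad_apply, LieHom.map_lie]

theorem wordsAction_mem_radical (y : FreeAlg) {x : Words} (hx : x ∈ radical) :
    wordsAction y x ∈ radical := by
  let K : LieSubalgebra ℂ FreeAlg :=
    { carrier := {y | ∀ x ∈ radical, wordsAction y x ∈ radical}
      add_mem' := fun {a b} ha hb x hx => by
        rw [map_add]; exact radical.add_mem (ha x hx) (hb x hx)
      zero_mem' := fun x _ => by rw [map_zero]; exact radical.zero_mem
      smul_mem' := fun r a ha x hx => by rw [map_smul]; exact radical.smul_mem r (ha x hx)
      lie_mem' := fun {a b} ha hb x hx => by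
        rw [LieHom.map_lie]; exact radical.sub_mem (ha _ (hb x hx)) (hb _ (ha x hx)) }
  have hK : K = ⊤ := by
    refine freeLieAlgebra_subalgebra_eq_top K ?_
    rintro (i | i | i) x hx
    · rw [wordsAction_H]; exact diag_mem_radical i hx
    · rw [wordsAction_E]; exact raise_mem_radical i hx
    · rw [wordsAction_F]; exact lower_mem_radical i hx
  have hy : y ∈ K := hK ▸ LieSubalgebra.mem_top y
  exact hy x hx

/-- The annihilator of the quotient of the Verma module by its radical. -/
def annihilator : LieIdeal ℂ FreeAlg where
  carrier := {y | ∀ x, wordsAction y x ∈ radical}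
  add_mem' := fun {a b} ha hb x => by
    rw [map_add]; exact radical.add_mem (ha x) (hb x)
  zero_mem' := fun x => by rw [map_zero]; exact radical.zero_mem
  smul_mem' := fun r a ha x => by rw [map_smul]; exact radical.smul_mem r (ha x)
  lie_mem := fun {y a} ha x => by
    rw [LieHom.map_lie]
    exact radical.sub_mem (wordsAction_mem_radical y (ha x)) (ha _)

theorem mem_annihilator {y : FreeAlg} : y ∈ annihilator ↔ ∀ x, wordsAction y x ∈ radical :=
  Iff.rfl

theorem mem_annihilator_of_eq_zero {y : FreeAlg} (h : wordsAction y = 0) : y ∈ annihilator :=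
  mem_annihilator.2 fun x => by rw [h]; exact radical.zero_mem

theorem toIdeal_le_annihilator : Relations.toIdeal ℂ cartanMatrix ≤ annihilator := by
  refine LieSubmodule.lieSpan_le.2 ?_
  rintro _ (((((⟨⟨i, j⟩, rfl⟩ | ⟨⟨i, j⟩, rfl⟩) | ⟨⟨i, j⟩, rfl⟩) | ⟨⟨i, j⟩, rfl⟩) | ⟨⟨i, j⟩, rfl⟩) |
    ⟨⟨i, j⟩, rfl⟩)
  · refine mem_annihilator_of_eq_zero ?_
    simp only [Relations.HH, Function.uncurry_apply_pair, Function.comp_apply, LieHom.map_lie,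
      wordsAction_H, diag_diag]
  · refine mem_annihilator_of_eq_zero ?_
    simp only [Relations.EF, Function.uncurry_apply_pair, Function.comp_apply]
    split_ifs with hij
    · subst hij
      rw [map_sub, LieHom.map_lie, wordsAction_E, wordsAction_F, wordsAction_H, raise_lower,
        if_pos rfl, sub_self]
    · rw [LieHom.map_lie, wordsAction_E, wordsAction_F, raise_lower, if_neg hij]
  · refine mem_annihilator_of_eq_zero ?_
    simp only [Relations.HE, Function.uncurry_apply_pair, Function.comp_apply, LieHom.map_lie,
      map_sub, map_zsmul, wordsAction_H, wordsAction_E]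
    refine sub_eq_zero.2 ((diag_raise i j).trans ?_)
    rw [one_mul]
    exact Int.cast_smul_eq_zsmul ℂ (cartanMatrix i j) (raise j)
  · refine mem_annihilator_of_eq_zero ?_
    simp only [Relations.HF, Function.uncurry_apply_pair, Function.comp_apply, LieHom.map_lie,
      map_add, map_zsmul, wordsAction_H, wordsAction_F]
    refine add_eq_zero_iff_eq_neg.2 ((diag_lower i j).trans ?_)
    rw [neg_mul, one_mul]
    exact (neg_smul (cartanMatrix i j : ℂ) (lower j)).trans
      (congrArg Neg.neg (Int.cast_smul_eq_zsmul ℂ (cartanMatrix i j) (lower j)))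
  · refine mem_annihilator_of_eq_zero ?_
    simp only [Relations.adE, Function.uncurry_apply_pair, Function.comp_apply,
      wordsAction_ad_pow, LieHom.map_lie, wordsAction_E, serre_raise_eq_zero]
  · refine mem_annihilator.2 fun x => ?_
    simp only [Relations.adF, Function.uncurry_apply_pair, Function.comp_apply,
      wordsAction_ad_pow, LieHom.map_lie, wordsAction_F]
    exact serre_lower_mem_radical i j x

/-- Applied to the word `[i]`, e_i gives the vacuum times the highest weight on the i-th coroot.
That weight is 1, so the result is outside the radical. -/
theorem posGen_ne_zero (i : Fin 10) : posGen i ≠ 0 := by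
  intro h
  have h1 : of ℂ (Generators.E i) ∈ annihilator :=
    toIdeal_le_annihilator ((proj_eq_zero_iff _).1 h)
  have h2 := mem_radical.1 (mem_annihilator.1 h1 (Finsupp.single [i] 1)) []
  rw [wordsAction_E, raise_single, raiseWord_cons, if_pos rfl] at h2
  simp [raiseWord, raiseList, vacuum, wordWeight] at h2

end Verma

/-! ### Multiplicity one along the Weyl orbit -/

section Multiplicity

theorem posGen_mem_rootSpace (i : Fin 10) : posGen i ∈ rootSpace (simpleRoot i) := by
  intro j
  rw [lie_coroot_posGen, form_simpleRoot, cartanMatrix_symm i j, Complex.ofReal_intCast]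

theorem rank_rootSpace_simpleRoot (i : Fin 10) : Module.rank ℂ (rootSpace (simpleRoot i)) = 1 := by
  have h : rootSpace (simpleRoot i) = Submodule.span ℂ {posGen i} :=
    le_antisymm (rootSpace_simpleRoot_le i)
      (Submodule.span_le.2 (Set.singleton_subset_iff.2 (posGen_mem_rootSpace i)))
  rw [h, Module.rank_eq_one_iff_finrank_eq_one]
  exact finrank_span_singleton (posGen_ne_zero i)

theorem form_weylGroup {w : Weight ≃ₗ[ℝ] Weight} (hw : w ∈ weylGroup) (a b : Weight) :
    form (w a) (w b) = form a b := by
  induction hw using Subgroup.closure_induction generalizing a b with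
  | mem x hx => obtain ⟨i, rfl⟩ := hx; exact form_simpleReflection i a b
  | one => rfl
  | mul x y _ _ hx hy => exact (hx (y a) (y b)).trans (hy a b)
  | inv x _ hx =>
    rw [← hx (x⁻¹ a) (x⁻¹ b)]
    exact congrArg₂ (fun u v => form u v) (x.apply_symm_apply a) (x.apply_symm_apply b)

/-- The Weyl orbit of the simple roots. -/
def realVectors : Set Weight := {n | ∃ w ∈ weylGroup, ∃ i, w n = simpleRoot i}

theorem simpleRoot_mem_realVectors (i : Fin 10) : simpleRoot i ∈ realVectors :=
  ⟨1, weylGroup.one_mem, i, rfl⟩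

theorem weylGroup_apply_mem_realVectors {w : Weight ≃ₗ[ℝ] Weight} (hw : w ∈ weylGroup)
    {n : Weight} (hn : n ∈ realVectors) : w n ∈ realVectors := by
  obtain ⟨u, hu, i, h⟩ := hn
  refine ⟨u * w⁻¹, weylGroup.mul_mem hu (weylGroup.inv_mem hw), i, ?_⟩
  rw [← h]
  exact congrArg u (w.symm_apply_apply n)

theorem simpleReflection_mem (i : Fin 10) : simpleReflection i ∈ weylGroup :=
  Subgroup.subset_closure ⟨i, rfl⟩

/-- A property of weights that holds for the simple roots and is preserved by the simple
reflections holds on their Weyl orbit. -/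
theorem realVectors_induction {P : Weight → Prop} (h0 : ∀ i, P (simpleRoot i))
    (h : ∀ i n, P n → P (simpleReflection i n)) {n : Weight} (hn : n ∈ realVectors) : P n := by
  obtain ⟨w, hw, i, hwi⟩ := hn
  -- An equivalence, unlike a single implication, passes to inverses in the group closure.
  have key : ∀ a, P a ↔ P (w a) := by
    clear hwi
    induction hw using Subgroup.closure_induction with
    | mem x hx =>
      obtain ⟨j, rfl⟩ := hx
      intro a
      refine ⟨h j a, fun ha => ?_⟩
      have := h j _ ha
      rwa [simpleReflection_simpleReflection] at this
    | one => exact fun _ => Iff.rfl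
    | mul x y _ _ hx hy => exact fun a => (hy a).trans (hx (y a))
    | inv x _ hx =>
      intro a
      rw [hx (x⁻¹ a)]
      exact iff_of_eq (congrArg P (x.apply_symm_apply a).symm)
  rw [key, hwi]
  exact h0 i

theorem rank_rootSpace_of_mem_realVectors {n : Weight} (hn : n ∈ realVectors) :
    Module.rank ℂ (rootSpace n) = 1 := by
  -- Integrality of the pairings with the simple roots is carried along because the invariance of
  -- the rank requires it.
  refine (realVectors_induction (P := fun n => (∀ i, ∃ m : ℤ, form n (simpleRoot i) = m) ∧
    Module.rank ℂ (rootSpace n) = 1) (fun i => ⟨fun j => ⟨_, form_simpleRoot i j⟩,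
      rank_rootSpace_simpleRoot i⟩) ?_ hn).2
  rintro i a ⟨ha, hr⟩
  obtain ⟨m, hm⟩ := ha i
  refine ⟨fun j => ?_, (rank_rootSpace_simpleReflection i a m hm).trans hr⟩
  obtain ⟨k, hk⟩ := ha j
  refine ⟨k - m * cartanMatrix i j, ?_⟩
  rw [simpleReflection_apply, map_sub, LinearMap.sub_apply, map_smul, LinearMap.smul_apply, hm, hk,
    form_simpleRoot, smul_eq_mul]
  push_cast
  rfl

theorem mult_of_mem_realVectors {n : Weight} (hn : n ∈ realVectors) : mult n = 1 :=
  Module.rank_eq_one_iff_finrank_eq_one.1 (rank_rootSpace_of_mem_realVectors hn)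

theorem form_self_of_mem_realVectors {n : Weight} (hn : n ∈ realVectors) : form n n = 2 := by
  obtain ⟨w, hw, i, h⟩ := hn
  rw [← form_weylGroup hw, h, form_simpleRoot_self]

/-- On the orbit the root condition is automatic: square 2 excludes the zero vector, and rank one
excludes a trivial root space. -/
theorem isRealRoot_iff {n : Weight} : IsRealRoot n ↔ n ∈ realVectors := by
  refine ⟨fun h => h.2, fun h => ⟨⟨?_, ?_⟩, h⟩⟩
  · rintro rfl
    have := form_self_of_mem_realVectors h
    simp at this
  · intro h0
    have := rank_rootSpace_of_mem_realVectors h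
    rw [h0, rank_bot] at this
    exact zero_ne_one this

end Multiplicity

end E10

end

noncomputable section

namespace E10

/-! ### Permutations, reflections and the root lattice -/

section Orbit

theorem simpleRoot_castSucc (i : Fin 9) :
    simpleRoot i.castSucc = Pi.single i.castSucc 1 - Pi.single i.succ 1 := by
  ext j
  fin_cases i <;> fin_cases j <;> simp [simpleRoot]

theorem form_simpleRoot_castSucc (n : Weight) (i : Fin 9) :
    form n (simpleRoot i.castSucc) = n i.castSucc - n i.succ := by
  rw [form_apply, simpleRoot_castSucc]
  simp [mul_sub, Finset.sum_sub_distrib, Pi.single_apply]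

theorem form_simpleRoot_last (n : Weight) :
    form n (simpleRoot 9) = n 7 + n 8 + n 9 - (1 / 3) * ∑ i, n i := by
  simp only [form_apply, simpleRoot, Fin.sum_univ_succ]
  simp
  ring

theorem simpleReflection_castSucc (i : Fin 9) (n : Weight) :
    simpleReflection i.castSucc n = n ∘ Equiv.swap i.castSucc i.succ := by
  rw [simpleReflection_apply, form_simpleRoot_castSucc, simpleRoot_castSucc]
  have hi : i.castSucc ≠ i.succ := (Fin.castSucc_lt_succ).ne
  ext j
  rw [Function.comp_apply, Equiv.swap_apply_def]
  split_ifs with h1 h2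
  · subst h1
    simp [hi]
  · subst h2
    simp [hi.symm]
  · simp [h1, h2]

theorem comp_perm_mem_realVectors {n : Weight} (hn : n ∈ realVectors) (σ : Equiv.Perm (Fin 10)) :
    n ∘ σ ∈ realVectors := by
  have hσ : σ ∈ Submonoid.closure
      (Set.range fun i : Fin 9 => Equiv.swap i.castSucc i.succ) := by
    rw [Equiv.Perm.mclosure_swap_castSucc_succ]
    trivial
  induction hσ using Submonoid.closure_induction generalizing n with
  | mem τ hτ =>
    obtain ⟨i, rfl⟩ := hτ
    rw [← simpleReflection_castSucc]
    exact weylGroup_apply_mem_realVectors (simpleReflection_mem _) hn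
  | one => exact hn
  | mul τ τ' _ _ h h' => exact h' (h hn)

/-- The reflection in a Weyl image of a simple root is a conjugate of a simple reflection. -/
theorem reflection_mem_realVectors {b n : Weight} (hb : b ∈ realVectors) (hn : n ∈ realVectors) :
    n - form n b • b ∈ realVectors := by
  obtain ⟨w, hw, i, h⟩ := hb
  have h1 : simpleReflection i (w n) = w (n - form n b • b) := by
    rw [simpleReflection_apply, map_sub, map_smul, h, ← h, form_weylGroup hw]
  have h2 := weylGroup_apply_mem_realVectors (weylGroup.inv_mem hw)
    (weylGroup_apply_mem_realVectors (simpleReflection_mem i)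
      (weylGroup_apply_mem_realVectors hw hn))
  rw [h1] at h2
  rwa [show w⁻¹ (w (n - form n b • b)) = _ from w.symm_apply_apply _] at h2

/-- The root lattice: integral vectors whose sum of coordinates is divisible by `3`. -/
def IsLatticeVector (n : Weight) : Prop :=
  ∃ (z : Fin 10 → ℤ) (l : ℤ), (n = fun i => (z i : ℝ)) ∧ ∑ i, z i = 3 * l

theorem form_intCast (z z' : Fin 10 → ℤ) (l l' : ℤ) (h : ∑ i, z i = 3 * l)
    (h' : ∑ i, z' i = 3 * l') :
    form (fun i => (z i : ℝ)) (fun i => (z' i : ℝ)) = ((∑ i, z i * z' i - l * l' : ℤ) : ℝ) := by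
  have e : ∑ i, (z i : ℝ) = 3 * l := by exact_mod_cast congrArg (Int.cast : ℤ → ℝ) h
  have e' : ∑ i, (z' i : ℝ) = 3 * l' := by exact_mod_cast congrArg (Int.cast : ℤ → ℝ) h'
  rw [form_apply, e, e']
  push_cast
  ring

theorem isLatticeVector_simpleRoot (i : Fin 10) : IsLatticeVector (simpleRoot i) := by
  refine Fin.lastCases ?_ (fun i => ?_) i
  · exact ⟨![0, 0, 0, 0, 0, 0, 0, 1, 1, 1], 1,
      by ext j; fin_cases j <;> simp [simpleRoot, Fin.last], by simp [Fin.sum_univ_succ]⟩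
  · refine ⟨Pi.single i.castSucc 1 - Pi.single i.succ 1, 0, ?_, by simp⟩
    rw [simpleRoot_castSucc]
    ext j
    simp [Pi.single_apply]

theorem isLatticeVector_of_mem_realVectors {n : Weight} (hn : n ∈ realVectors) :
    IsLatticeVector n := by
  refine realVectors_induction isLatticeVector_simpleRoot ?_ hn
  rintro i _ ⟨z, l, rfl, hz⟩
  obtain ⟨y, k, hy, hk⟩ := isLatticeVector_simpleRoot i
  rw [simpleReflection_apply, hy, form_intCast z y l k hz hk]
  refine ⟨fun j => z j - (∑ i, z i * y i - l * k) * y j,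
    l - (∑ i, z i * y i - l * k) * k, ?_, ?_⟩
  · ext j
    simp
  · rw [Finset.sum_sub_distrib, ← Finset.mul_sum, hz, hk]
    ring

end Orbit

/-! ### Classification of the orbit vectors with at least two singletons -/

section Classification

/-- The table with integer entries. -/
def tableInt : Fin 15 → Fin 10 → ℤ :=
  ![![0, 0, 0, 0, 0, 0, 0, 1, 1, 1],
    ![0, 0, 0, 0, 1, 1, 1, 1, 1, 1],
    ![0, 0, 1, 1, 1, 1, 1, 1, 1, 2],
    ![0, 1, 1, 1, 1, 1, 1, 2, 2, 2],
    ![0, 1, 1, 1, 2, 2, 2, 2, 2, 2],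
    ![1, 1, 1, 1, 1, 1, 1, 1, 1, 3],
    ![1, 1, 1, 1, 1, 1, 2, 2, 2, 3],
    ![1, 1, 1, 1, 2, 2, 2, 2, 3, 3],
    ![1, 1, 1, 2, 2, 2, 3, 3, 3, 3],
    ![1, 1, 1, 3, 3, 3, 3, 3, 3, 3],
    ![1, 1, 2, 2, 2, 2, 2, 2, 3, 4],
    ![1, 1, 2, 2, 2, 3, 3, 3, 3, 4],
    ![1, 1, 2, 3, 3, 3, 3, 3, 4, 4],
    ![1, 1, 3, 3, 3, 3, 4, 4, 4, 4],
    ![1, 1, 3, 4, 4, 4, 4, 4, 4, 4]]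

theorem table_eq (k : Fin 15) : table k = fun i => (tableInt k i : ℝ) := by
  ext i
  fin_cases k <;> fin_cases i <;> simp [table, tableInt]

/-- The number of coordinates with a given value. -/
def valueCount (z : Fin 10 → ℤ) (v : ℤ) : ℕ := (Finset.univ.filter fun i => z i = v).card

theorem sum_eq_sum_valueCount (z : Fin 10 → ℤ) (hz : ∀ i, z i ∈ Finset.Icc (0 : ℤ) 4)
    (f : ℤ → ℤ) : ∑ i, f (z i) = ∑ v ∈ Finset.Icc (0 : ℤ) 4, valueCount z v * f v := by
  rw [← Finset.sum_fiberwise_of_maps_to (fun i _ => hz i)]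
  refine Finset.sum_congr rfl fun v _ => ?_
  rw [Finset.sum_congr rfl (g := fun _ => f v) fun i hi => by rw [(Finset.mem_filter.1 hi).2],
    Finset.sum_const, nsmul_eq_mul]
  rfl

theorem exists_perm_of_valueCount_eq (z y : Fin 10 → ℤ) (hz : ∀ i, z i ∈ Finset.Icc (0 : ℤ) 4)
    (hy : ∀ i, y i ∈ Finset.Icc (0 : ℤ) 4)
    (h : ∀ v ∈ Finset.Icc (0 : ℤ) 4, valueCount z v = valueCount y v) :
    ∃ σ : Equiv.Perm (Fin 10), z = y ∘ σ := by
  have hcard : ∀ v, Fintype.card {i // z i = v} = Fintype.card {i // y i = v} := by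
    intro v
    by_cases hv : v ∈ Finset.Icc (0 : ℤ) 4
    · rw [Fintype.card_subtype, Fintype.card_subtype]
      exact h v hv
    · have h1 : IsEmpty {i // z i = v} := ⟨fun i => hv (i.2 ▸ hz i.1)⟩
      have h2 : IsEmpty {i // y i = v} := ⟨fun i => hv (i.2 ▸ hy i.1)⟩
      rw [Fintype.card_eq_zero, Fintype.card_eq_zero]
  refine ⟨Equiv.ofFiberEquiv fun v => Fintype.equivOfCardEq (hcard v), ?_⟩
  ext i
  exact (Equiv.ofFiberEquiv_map _ i).symm

theorem tableInt_mem_Icc : ∀ k i, tableInt k i ∈ Finset.Icc (0 : ℤ) 4 := by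
  decide +kernel

set_option synthInstance.maxHeartbeats 400000 in
set_option synthInstance.maxSize 4000 in
-- Here `b`, `a`, `c` count the coordinates 2, 3, 4. The equation is half the sum of z(z - 1); the
-- two inequalities say that there are at least two ones and that the nonzero coordinates number at
-- most ten. Truncated subtraction is harmless in the equation, since l² + 2 - 3l = (l - 1)(l - 2)
-- is nonnegative and even.
theorem exists_table_valueCount : ∀ l < 12, ∀ a < 11, ∀ b < 11, ∀ c < 11,
    b + 3 * a + 6 * c = (l * l + 2 - 3 * l) / 2 → 2 * b + 3 * a + 4 * c + 2 ≤ 3 * l →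
    3 * l ≤ 10 + b + 2 * a + 3 * c →
    ∃ k, valueCount (tableInt k) 2 = b ∧ valueCount (tableInt k) 3 = a ∧
      valueCount (tableInt k) 4 = c ∧
      valueCount (tableInt k) 1 = 3 * l - (2 * b + 3 * a + 4 * c) := by
  decide +kernel

theorem Icc_zero_four : Finset.Icc (0 : ℤ) 4 = {0, 1, 2, 3, 4} := by decide

theorem exists_perm_table (z : Fin 10 → ℤ) (l : ℤ) (h1 : ∑ i, z i = 3 * l)
    (h2 : ∑ i, z i * z i = l * l + 2) (hs : 2 ≤ valueCount z 1) :
    ∃ (k : Fin 15) (σ : Equiv.Perm (Fin 10)), z = tableInt k ∘ σ := by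
  obtain ⟨p, hp, q, hq, hpq⟩ := Finset.one_lt_card.1 hs
  have hp' : z p = 1 := (Finset.mem_filter.1 hp).2
  have hq' : z q = 1 := (Finset.mem_filter.1 hq).2
  set S : Finset (Fin 10) := (Finset.univ.erase p).erase q with hS
  have hqS : q ∈ Finset.univ.erase p := by simp [hpq.symm]
  have hcard : S.card = 8 := by
    rw [hS, Finset.card_erase_of_mem hqS, Finset.card_erase_of_mem (Finset.mem_univ p)]
    simp
  have hsum : ∀ f : ℤ → ℤ, ∑ i ∈ S, f (z i) = ∑ i, f (z i) - 2 * f 1 := by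
    intro f
    rw [← Finset.add_sum_erase _ _ (Finset.mem_univ p), ← Finset.add_sum_erase _ _ hqS, hp', hq']
    ring
  have hS1 : ∑ i ∈ S, z i = 3 * l - 2 := by
    rw [hsum fun x => x, h1]; ring
  have hS2 : ∑ i ∈ S, z i ^ 2 = l * l := by
    rw [hsum fun x => x ^ 2]
    simp only [sq, h2]; ring
  -- Cauchy-Schwarz on the eight remaining coordinates: (3l - 2)² ≤ 8l².
  have hl : l * l - 12 * l + 4 ≤ 0 := by
    have := sq_sum_le_card_mul_sum_sq (s := S) (f := z)
    rw [hS1, hS2, hcard] at this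
    push_cast at this
    nlinarith
  have hl1 : 1 ≤ l := by by_contra! h; nlinarith
  have hl2 : l ≤ 11 := by by_contra! h; nlinarith
  have hz : ∀ i, z i ∈ Finset.Icc (0 : ℤ) 4 := by
    intro i
    by_cases hi : i ∈ S
    · have hc := sq_sum_le_card_mul_sum_sq (s := S.erase i) (f := z)
      have e1 := Finset.add_sum_erase S z hi
      have e2 := Finset.add_sum_erase S (fun i => z i ^ 2) hi
      rw [hS1] at e1
      rw [hS2] at e2
      rw [Finset.card_erase_of_mem hi, hcard, eq_sub_iff_add_eq'.2 e1,
        eq_sub_iff_add_eq'.2 e2] at hc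
      push_cast at hc
      rw [Finset.mem_Icc]
      generalize z i = x at hc
      clear * - hc hl1 hl2
      constructor
      · by_contra! h
        interval_cases l <;> nlinarith
      · by_contra! h
        interval_cases l <;> nlinarith
    · have : z i = 1 := by
        by_cases h : i = q
        · rw [h, hq']
        · have : i = p := by
            by_contra h'
            exact hi (by simp [hS, h, h'])
          rw [this, hp']
      simp [this]
  have c0 := sum_eq_sum_valueCount z hz fun _ => 1
  have c1 := sum_eq_sum_valueCount z hz fun x => x
  have c2 := sum_eq_sum_valueCount z hz fun x => x * x
  rw [h1] at c1
  rw [h2] at c2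
  simp [Icc_zero_four] at c0 c1 c2
  lift l to ℕ using by omega
  obtain ⟨k, k2, k3, k4, k1⟩ := exists_table_valueCount l (by omega) (valueCount z 3) (by omega)
    (valueCount z 2) (by omega) (valueCount z 4) (by omega) (by
      have : l * l + 2 = 2 * (valueCount z 2 + 3 * valueCount z 3 + 6 * valueCount z 4) + 3 * l := by
        zify; linarith
      omega) (by omega) (by omega)
  have d0 := sum_eq_sum_valueCount (tableInt k) (tableInt_mem_Icc k) fun _ => 1
  simp [Icc_zero_four] at d0
  refine ⟨k, exists_perm_of_valueCount_eq _ _ hz (tableInt_mem_Icc k) fun v hv => ?_⟩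
  rw [Icc_zero_four] at hv
  simp only [Finset.mem_insert, Finset.mem_singleton] at hv
  rcases hv with rfl | rfl | rfl | rfl | rfl <;> omega

theorem singletonCount_intCast (z : Fin 10 → ℤ) :
    singletonCount (fun i => (z i : ℝ)) = valueCount z 1 := by
  simp only [singletonCount, valueCount]
  congr 1
  ext i
  simp

theorem doubletonCount_intCast (z : Fin 10 → ℤ) :
    doubletonCount (fun i => (z i : ℝ)) = valueCount z 2 := by
  simp only [doubletonCount, valueCount]
  congr 1
  ext i
  simp only [Finset.mem_filter, Finset.mem_univ, true_and]
  norm_cast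

theorem exists_perm_table_of_mem_realVectors {n : Weight} (hn : n ∈ realVectors)
    (hs : 2 ≤ singletonCount n) :
    ∃ (k : Fin 15) (σ : Equiv.Perm (Fin 10)), n = table k ∘ σ := by
  have h2 := form_self_of_mem_realVectors hn
  obtain ⟨z, l, rfl, hz⟩ := isLatticeVector_of_mem_realVectors hn
  rw [form_intCast z z l l hz hz] at h2
  have h2' : ∑ i, z i * z i - l * l = 2 := by exact_mod_cast h2
  rw [singletonCount_intCast] at hs
  obtain ⟨k, σ, rfl⟩ := exists_perm_table z l hz (by omega) hs
  exact ⟨k, σ, by rw [table_eq]; rfl⟩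

/-- The reflection in the last simple root, on integral vectors of coordinate sum `3 * l`. -/
def lastReflection (z : Fin 10 → ℤ) (l : ℤ) (i : Fin 10) : ℤ :=
  if 7 ≤ i then z i - (z 7 + z 8 + z 9 - l) else z i

theorem simpleReflection_last (z : Fin 10 → ℤ) (l : ℤ) (h : ∑ i, z i = 3 * l) :
    simpleReflection 9 (fun i => (z i : ℝ)) = fun i => (lastReflection z l i : ℝ) := by
  have e : ∑ i, (z i : ℝ) = 3 * l := by exact_mod_cast congrArg (Int.cast : ℤ → ℝ) h
  rw [simpleReflection_apply, form_simpleRoot_last, e]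
  ext i
  fin_cases i <;> simp [simpleRoot, lastReflection]

/-- The descent step: one reflection leads to an earlier vector up to permutation. Permutations are
compared through value counts, which keeps the check finite and small. -/
theorem exists_lastReflection_table : ∀ k : Fin 15, k ≠ 0 → ∃ k' < k, ∃ l ∈ Finset.Icc (0 : ℤ) 11,
    ∑ i, tableInt k i = 3 * l ∧
    (∀ i, lastReflection (tableInt k) l i ∈ Finset.Icc (0 : ℤ) 4) ∧
    ∀ v ∈ Finset.Icc (0 : ℤ) 4,
      valueCount (lastReflection (tableInt k) l) v = valueCount (tableInt k') v := by
  decide +kernel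

theorem table_mem_realVectors (k : Fin 15) : table k ∈ realVectors := by
  induction k using WellFoundedLT.induction with
  | ind k ih =>
    by_cases hk : k = 0
    · subst hk
      exact simpleRoot_mem_realVectors 9
    · obtain ⟨k', hk', l, -, hl, hi, hv⟩ := exists_lastReflection_table k hk
      obtain ⟨σ, hσ⟩ := exists_perm_of_valueCount_eq _ _ hi (tableInt_mem_Icc k') hv
      rw [table_eq, ← simpleReflection_simpleReflection 9 fun i => (tableInt k i : ℝ),
        simpleReflection_last _ l hl, hσ]
      refine weylGroup_apply_mem_realVectors (simpleReflection_mem 9) ?_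
      have := comp_perm_mem_realVectors (ih k' hk') σ
      rwa [table_eq] at this

end Classification

/-! ### Infinitely many real roots with one singleton -/

section InfiniteFamily

/-- A family of real roots, obtained from a simple root by the powers of a translation in the
affine Weyl group of the coordinates after the first. -/
def translates (m : ℕ) : Weight :=
  ![1, (m : ℝ) ^ 2 - 1, m ^ 2 + 2 * m, m ^ 2 + m, m ^ 2 + m, m ^ 2 + m, m ^ 2 + m, m ^ 2 + m,
    m ^ 2 + m, m ^ 2 + m]

theorem translates_mem_realVectors (m : ℕ) : translates m ∈ realVectors := by
  induction m with
  | zero =>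
    convert simpleRoot_mem_realVectors 0 using 1
    ext i
    fin_cases i <;> simp [translates, simpleRoot]
  | succ m ih =>
    -- This root is δ + β, with δ = (0, 1, ..., 1) of square 0 and β = (0, -1, 1, 0, ..., 0). The
    -- swap of coordinates 1 and 2 is the reflection in β; followed by the reflection in δ + β it is
    -- a translation of the affine Weyl group. Both roots vanish at coordinate 0, which therefore
    -- stays 1.
    have hγ : (![0, 0, 2, 1, 1, 1, 1, 1, 1, 1] : Weight) ∈ realVectors := by
      convert comp_perm_mem_realVectors (table_mem_realVectors 2) (Equiv.swap 2 9) using 1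
      ext i
      fin_cases i <;> simp [table, Equiv.swap_apply_def]
    have h := reflection_mem_realVectors hγ (comp_perm_mem_realVectors ih (Equiv.swap 1 2))
    have hn : translates m ∘ Equiv.swap 1 2 =
        (![1, m ^ 2 + 2 * m, m ^ 2 - 1, m ^ 2 + m, m ^ 2 + m, m ^ 2 + m, m ^ 2 + m, m ^ 2 + m,
          m ^ 2 + m, m ^ 2 + m] : Weight) := by
      ext i
      fin_cases i <;> simp [translates, Equiv.swap_apply_def]
    rw [hn] at h
    convert h using 1
    ext i
    fin_cases i <;> simp [translates, form_apply, Fin.sum_univ_succ] <;> ring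

/-- The shift by 2 makes every coordinate after the first at least 3. -/
theorem singletonCount_translates (m : ℕ) : singletonCount (translates (m + 2)) = 1 := by
  rw [singletonCount, Finset.card_eq_one]
  refine ⟨0, ?_⟩
  ext i
  rw [Finset.mem_filter, Finset.mem_singleton]
  have hm : (0 : ℝ) ≤ m := m.cast_nonneg
  fin_cases i <;> simp [translates] <;> nlinarith

theorem translates_injective : Function.Injective translates := by
  intro a b h
  simpa [translates] using congrFun h 1

theorem infinite_singletonCount_eq_one :
    {n : Weight | n ∈ realVectors ∧ singletonCount n = 1}.Infinite :=
  Set.infinite_of_injective_forall_mem (f := fun m => translates (m + 2))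
    (fun _ _ h => Nat.add_right_cancel (translates_injective h))
    fun m => ⟨translates_mem_realVectors _, singletonCount_translates m⟩

end InfiniteFamily

end E10

end

noncomputable section

namespace E10

/-! ### Actions determine their exponents -/

section Branes

/-- Setting one radius to 2 and all other variables to 1 isolates one exponent. -/
theorem action_injective {n n' : Weight}
    (h : ∀ (Mp : ℝ) (R : Fin 10 → ℝ), 0 < Mp → (∀ i, 0 < R i) → action n Mp R = action n' Mp R) :
    n = n' := by
  have key : ∀ (n : Weight) (j : Fin 10),
      action n 1 (Function.update 1 j 2) = 2 * Real.pi * 2 ^ n j := by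
    intro n j
    rw [action, Finset.prod_eq_single j]
    · simp
    · intro i _ hi
      simp [Function.update_of_ne hi]
    · simp
  ext j
  have hj := h 1 (Function.update 1 j 2) one_pos fun i => by
    by_cases hi : i = j
    · subst hi; simp
    · simp [Function.update_of_ne hi]
  rw [key, key] at hj
  exact (Real.rpow_right_inj two_pos (by norm_num)).1
    (mul_left_cancel₀ (by positivity : 2 * Real.pi ≠ 0) hj)

theorem actionIIA_injective {n n' : Weight}
    (h : ∀ (gs Ms : ℝ) (l : Fin 9 → ℝ), 0 < gs → 0 < Ms → (∀ i, 0 < l i) →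
      actionIIA n gs Ms l = actionIIA n' gs Ms l) : n = n' := by
  have hpi : 2 * Real.pi ≠ 0 := by positivity
  have key : ∀ (n : Weight) (j : Fin 9),
      actionIIA n 1 1 (Function.update 1 j 2) = 2 * Real.pi * 2 ^ n j.castSucc := by
    intro n j
    rw [actionIIA, Finset.prod_eq_single j]
    · simp
    · intro i _ hi
      simp [Function.update_of_ne hi]
    · simp
  have h9 : ∀ j : Fin 9, n j.castSucc = n' j.castSucc := by
    intro j
    have hj := h 1 1 (Function.update 1 j 2) one_pos one_pos fun i => by
      by_cases hi : i = j
      · subst hi; simp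
      · simp [Function.update_of_ne hi]
    rw [key, key] at hj
    exact (Real.rpow_right_inj two_pos (by norm_num)).1 (mul_left_cancel₀ hpi hj)
  -- The power of g_s supplies the missing tenth coordinate: once the first nine agree, it enters m₀
  -- with the nonzero coefficient -1 + 1/3.
  have hg := h 2 1 1 two_pos one_pos fun i => one_pos
  simp only [actionIIA, Pi.one_apply, mul_one, Real.one_rpow, Finset.prod_const_one] at hg
  have hg' := (Real.rpow_right_inj two_pos (by norm_num)).1 (mul_left_cancel₀ hpi hg)
  rw [Fin.sum_univ_castSucc n, Fin.sum_univ_castSucc n', Finset.sum_congr rfl fun j _ => h9 j] at hg'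
  have hl : n (Fin.last 9) = n' (Fin.last 9) := by
    change -(-n (Fin.last 9) + _) = -(-n' (Fin.last 9) + _) at hg'
    linarith
  ext j
  exact Fin.lastCases hl h9 j

theorem isM2BraneRoot_iff (n : Weight) : IsM2BraneRoot n ↔ n = table 0 := by
  have h : IsM2BraneRoot (table 0) := by
    intro Mp R _ _
    simp [action, table, Fin.prod_univ_succ]
    ring
  exact ⟨fun hn => action_injective fun Mp R hM hR => (hn Mp R hM hR).trans (h Mp R hM hR).symm,
    fun hn => hn ▸ h⟩

theorem isM5BraneRoot_iff (n : Weight) : IsM5BraneRoot n ↔ n = table 1 := by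
  have h : IsM5BraneRoot (table 1) := by
    intro Mp R _ _
    simp [action, table, Fin.prod_univ_succ]
    ring
  exact ⟨fun hn => action_injective fun Mp R hM hR => (hn Mp R hM hR).trans (h Mp R hM hR).symm,
    fun hn => hn ▸ h⟩

theorem isKKMonopoleRoot_iff (n : Weight) : IsKKMonopoleRoot n ↔ n = table 2 := by
  have h : IsKKMonopoleRoot (table 2) := by
    intro Mp R _ _
    simp [action, table, Fin.prod_univ_succ]
    ring
  exact ⟨fun hn => action_injective fun Mp R hM hR => (hn Mp R hM hR).trans (h Mp R hM hR).symm,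
    fun hn => hn ▸ h⟩

theorem isD8BraneRoot_iff (n : Weight) : IsD8BraneRoot n ↔ n = table 5 := by
  have h : IsD8BraneRoot (table 5) := by
    intro gs Ms l _ _ _
    have h1 : -(-table 5 9 + (1 / 3) * ∑ i, table 5 i) = -1 := by
      simp [table, Fin.sum_univ_succ]
      norm_num
    have h2 : ∀ i : Fin 9, table 5 i.castSucc = 1 := by
      intro i
      fin_cases i <;> rfl
    simp only [actionIIA, h1, h2, Real.rpow_one, Real.rpow_neg_one, Finset.prod_mul_distrib,
      Finset.prod_const, Finset.card_univ, Fintype.card_fin]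
    ring
  exact ⟨fun hn => actionIIA_injective fun gs Ms l hg hM hl =>
    (hn gs Ms l hg hM hl).trans (h gs Ms l hg hM hl).symm, fun hn => hn ▸ h⟩

end Branes

theorem singletonCount_comp_perm (n : Weight) (σ : Equiv.Perm (Fin 10)) :
    singletonCount (n ∘ σ) = singletonCount n :=
  Finset.card_equiv σ fun i => by simp

theorem doubletonCount_comp_perm (n : Weight) (σ : Equiv.Perm (Fin 10)) :
    doubletonCount (n ∘ σ) = doubletonCount n :=
  Finset.card_equiv σ fun i => by simp

theorem singletonCount_table (k : Fin 15) : singletonCount (table k) = tableSingleton k := by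
  rw [table_eq, singletonCount_intCast]
  revert k
  decide +kernel

theorem doubletonCount_table (k : Fin 15) : doubletonCount (table k) = tableDoubleton k := by
  rw [table_eq, doubletonCount_intCast]
  revert k
  decide +kernel

theorem two_le_tableSingleton (k : Fin 15) : 2 ≤ tableSingleton k := by
  revert k
  decide +kernel

end E10

end

theorem mainTheorem2 :
    -- the real roots with singleton count at least two are the permutations of the listed vectors
    (∀ n : E10.Weight, (E10.IsRealRoot n ∧ 2 ≤ E10.singletonCount n) ↔
      ∃ (k : Fin 15) (σ : Equiv.Perm (Fin 10)), n = E10.table k ∘ σ) ∧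
    -- squares, multiplicities, singleton counts and doubleton counts
    (∀ (k : Fin 15) (σ : Equiv.Perm (Fin 10)),
      E10.form (E10.table k ∘ σ) (E10.table k ∘ σ) = 2 ∧
      E10.mult (E10.table k ∘ σ) = 1 ∧
      E10.singletonCount (E10.table k ∘ σ) = E10.tableSingleton k ∧
      E10.doubletonCount (E10.table k ∘ σ) = E10.tableDoubleton k) ∧
    -- the roots of the familiar branes
    (∀ n : E10.Weight, E10.IsM2BraneRoot n ↔ n = E10.table 0) ∧
    (∀ n : E10.Weight, E10.IsM5BraneRoot n ↔ n = E10.table 1) ∧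
    (∀ n : E10.Weight, E10.IsKKMonopoleRoot n ↔ n = E10.table 2) ∧
    (∀ n : E10.Weight, E10.IsD8BraneRoot n ↔ n = E10.table 5) ∧
    -- infinitely many real roots with singleton count one
    {n : E10.Weight | E10.IsRealRoot n ∧ E10.singletonCount n = 1}.Infinite := by
  have hmem : ∀ (k : Fin 15) (σ : Equiv.Perm (Fin 10)), E10.table k ∘ σ ∈ E10.realVectors :=
    fun k σ => E10.comp_perm_mem_realVectors (E10.table_mem_realVectors k) σ
  refine ⟨fun n => ⟨fun h => ?_, ?_⟩, fun k σ => ⟨?_, ?_, ?_, ?_⟩, E10.isM2BraneRoot_iff,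
    E10.isM5BraneRoot_iff, E10.isKKMonopoleRoot_iff, E10.isD8BraneRoot_iff, ?_⟩
  · exact E10.exists_perm_table_of_mem_realVectors (E10.isRealRoot_iff.1 h.1) h.2
  · rintro ⟨k, σ, rfl⟩
    refine ⟨E10.isRealRoot_iff.2 (hmem k σ), ?_⟩
    rw [E10.singletonCount_comp_perm, E10.singletonCount_table]
    exact E10.two_le_tableSingleton k
  · exact E10.form_self_of_mem_realVectors (hmem k σ)
  · exact E10.mult_of_mem_realVectors (hmem k σ)
  · rw [E10.singletonCount_comp_perm, E10.singletonCount_table]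
  · rw [E10.doubletonCount_comp_perm, E10.doubletonCount_table]
  · simp only [E10.isRealRoot_iff]
    exact E10.infinite_singletonCount_eq_one
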